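/- Let $\sigma>1$. For $u\in C^\infty(\mathbf R^n)$ write $u\in G^\sigma(\mathbf R^n)$ if for every compact $K$ there is $C>0$ with $|\partial^\alpha u|\le C^{|\alpha|+1}(\alpha!)^\sigma$ on $K$ for all multi-indices $\alpha$. Let $a,b\in G^\sigma(\mathbf R^2)$ be real-valued, and let $0\le\phi\in G^\sigma(\mathbf R)$ be even with $\operatorname{supp}\phi\subset[-1,1]$ and $\int\phi=1$. Put $\phi_\delta(t)=\delta^{-1}\phi(t/\delta)$. For $m\in C^\infty(\mathbf R^3)$ real-valued and $f$ continuous and complex-valued on $\mathbf R^2$ with $\operatorname{supp}f\subset\{(x,y):y\ge x^2\}$, set $$R_m[f](\xi,\eta)=\int_{\mathbf R}f(x,\xi x+\eta)\,m(x,\xi,\eta)\,dx,\qquad m_\gamma(x,y)=m\Big(x,\frac{y-\gamma}{x},\gamma\Big)\quad(x\ne0),$$ $$\mathcal M_{\varepsilon,\gamma}[fm_\gamma](x)=\int_{|y-\gamma|\le\varepsilon|x|}f(x,y)\,m_\gamma(x,y)\,\phi_{\varepsilon|x|}(\gamma-y)\,dy\quad(x\neq0),\qquad \mathcal M_{\varepsilon,\gamma}[fm_\gamma](0)=f(0,\gamma)\,m(0,0,\gamma),$$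 and $m_k(u)=\int_{\mathbf R}x^ku(x)\,dx$. Let $\Gamma>0$ and $c>0$. Let $\|\cdot\|_{\varepsilon,\gamma}$ be any family of norms (or just real-valued functionals) on the data such that, for all continuous $g$ on $\mathbf R^2$ and all $\varepsilon>0$, $\varepsilon^2/4\le\gamma\le\Gamma$, $$\max\Big\{\int_{|\xi|\le\varepsilon,\,|\eta|<\gamma}|g(\xi,\eta)|\,d\xi\,d\eta,\ \int_{-\varepsilon}^{\varepsilon}|g(\xi,\gamma)|\,d\xi\Big\}\le c\,\|g\|_{\varepsilon,\gamma};$$ for example $\|g\|_{\varepsilon,\gamma}=\sup_{|\eta|\le\gamma}\int_{-\varepsilon}^{\varepsilon}|g(\xi,\eta)|\,d\xi$, with $c=\max\{1,2\Gamma\}$. **Proposition.** There is a constant $C>0$, depending only on $\sigma,a,b,\phi,\Gamma,c$, such that the following holds for every such family $\|\cdot\|_{\varepsilon,\gamma}$. If $m\in C^\infty(\mathbf R^3)$ satisfies $$\partial_\xi m(x,\xi,\eta)-x\,\partial_\eta m(x,\xi,\eta)=\big(x\,a(\xi,\eta)+b(\xi,\eta)\big)\,m(x,\xi,\eta)\quad\text{on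 }\mathbf R^3,$$ $f$ is continuous with $\operatorname{supp}f\subset\{(x,y):y\ge x^2\}$, and $\varepsilon>0$, $\varepsilon^2/4\le\gamma\le\Gamma$, then for all $k=0,1,2,\dots$ the function $x^k\mathcal M_{\varepsilon,\gamma}[fm_\gamma](x)$ is integrable on $\mathbf R$ and $$\big|m_k(\mathcal M_{\varepsilon,\gamma}[fm_\gamma])\big|\le\Big(\frac C\varepsilon\Big)^{k+1}k!^{\,s}\,\|R_m[f]\|_{\varepsilon,\gamma},\qquad s=\sigma-1.$$ -/

import Mathlib

open MeasureTheory Set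
open scoped Nat ContDiff

noncomputable section

namespace LocalRadon

/-- `u ∈ G^σ(ℝ)`: smooth, and on every compact set `|u^{(i)}| ≤ C^{i+1} (i!)^σ` for all `i`. -/
def IsGevrey (σ : ℝ) (u : ℝ → ℝ) : Prop :=
  ContDiff ℝ ∞ u ∧
    ∀ K : Set ℝ, IsCompact K → ∃ C : ℝ, 0 < C ∧ ∀ i : ℕ, ∀ t ∈ K,
      |iteratedDeriv i u t| ≤ C ^ (i + 1) * (i ! : ℝ) ^ σ

/-- The mixed partial derivative `∂_ξ^i ∂_η^j u (ξ, η)`. -/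
def mixedPartial (i j : ℕ) (u : ℝ → ℝ → ℝ) (ξ η : ℝ) : ℝ :=
  iteratedDeriv i (fun ξ' => iteratedDeriv j (fun η' => u ξ' η') η) ξ

/-- `u ∈ G^σ(ℝ²)`: smooth, and on every compact set
`|∂_ξ^i ∂_η^j u| ≤ C^{i+j+1} (i! j!)^σ` for all multi-indices `(i, j)`. -/
def IsGevrey₂ (σ : ℝ) (u : ℝ → ℝ → ℝ) : Prop :=
  ContDiff ℝ ∞ (fun p : ℝ × ℝ => u p.1 p.2) ∧
    ∀ K : Set (ℝ × ℝ), IsCompact K → ∃ C : ℝ, 0 < C ∧ ∀ i j : ℕ, ∀ p ∈ K,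
      |mixedPartial i j u p.1 p.2| ≤ C ^ (i + j + 1) * ((i ! : ℝ) * (j ! : ℝ)) ^ σ

/-- The test functions defining the means: nonnegative even functions of class `G₀^σ(ℝ)`,
supported in `[-1, 1]` and of integral one. -/
structure IsTestFunction (σ : ℝ) (ϕ : ℝ → ℝ) : Prop where
  gevrey : IsGevrey σ ϕ
  support_subset : tsupport ϕ ⊆ Icc (-1) 1
  nonneg : ∀ t, 0 ≤ ϕ t
  even : ∀ t, ϕ (-t) = ϕ t
  integral_eq_one : ∫ t, ϕ t = 1

/-- The dilation `ϕ_δ(t) = δ⁻¹ ϕ(t / δ)`. -/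
def dilate (ϕ : ℝ → ℝ) (δ t : ℝ) : ℝ := δ⁻¹ * ϕ (t / δ)

/-- The mean `M_{ε,γ}[F](x) = ∫_{|y-γ| ≤ ε|x|} F(x,y) ϕ_{ε|x|}(γ-y) dy` for `x ≠ 0`,
and `M_{ε,γ}[F](0) = F(0,γ)`. -/
def mean (ϕ : ℝ → ℝ) (ε γ : ℝ) (F : ℝ → ℝ → ℂ) (x : ℝ) : ℂ :=
  if x = 0 then F 0 γ
  else ∫ y in {y : ℝ | |y - γ| ≤ ε * |x|}, F x y * (dilate ϕ (ε * |x|) (γ - y) : ℂ)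

/-- The function `f m_γ`, where `m_γ(x,y) = m(x, (y-γ)/x, γ)` for `x ≠ 0`.
At the point `(0, γ)`, the only point with `x = 0` that `mean` uses, its value is
`f(0,γ) m(0,0,γ)`: the quotient `(γ - γ)/0` is `0` in Lean. -/
def mulWeight (f : ℝ → ℝ → ℂ) (m : ℝ → ℝ → ℝ → ℝ) (γ : ℝ) (x y : ℝ) : ℂ :=
  f x y * (m x ((y - γ) / x) γ : ℂ)

/-- The weighted Radon transform `R_m[f](ξ,η) = ∫ f(x, ξx+η) m(x,ξ,η) dx`. -/
def weightedRadon (m : ℝ → ℝ → ℝ → ℝ) (f : ℝ → ℝ → ℂ) (ξ η : ℝ) : ℂ :=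
  ∫ x, f x (ξ * x + η) * (m x ξ η : ℂ)

/-- The equation `∂_ξ m - x ∂_η m = (x a(ξ,η) + b(ξ,η)) m` on `ℝ³`. -/
def SolvesWeightEquation (a b : ℝ → ℝ → ℝ) (m : ℝ → ℝ → ℝ → ℝ) : Prop :=
  ∀ x ξ η : ℝ,
    deriv (fun ξ' => m x ξ' η) ξ - x * deriv (fun η' => m x ξ η') η
      = (x * a ξ η + b ξ η) * m x ξ η

/-- The `k`-th moment `m_k[u] = ∫ x^k u(x) dx`. -/
def moment (k : ℕ) (u : ℝ → ℂ) : ℂ := ∫ x : ℝ, (x : ℂ) ^ k * u x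

/-- The `L¹` norm over the rectangle `R_{ε,γ} = {|ξ| ≤ ε, |η| < γ}`. -/
def rectNorm (ε γ : ℝ) (g : ℝ → ℝ → ℂ) : ℝ :=
  ∫ p in Icc (-ε) ε ×ˢ Ioo (-γ) γ, ‖g p.1 p.2‖

/-- The norm `‖g(·, η)‖_{L¹[-ε,ε]}`. -/
def lineNorm (ε η : ℝ) (g : ℝ → ℝ → ℂ) : ℝ :=
  ∫ ξ in Icc (-ε) ε, ‖g ξ η‖

/-- The property asked of a norm `‖·‖_{ε,γ}` on the data: up to a factor `c`, it dominates
`max {‖g‖_{L¹(R_{ε,γ})}, ‖g(·,γ)‖_{L¹[-ε,ε]}}`. Only continuous `g` and the range of parameters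
`0 < ε`, `ε²/4 ≤ γ ≤ Γ` are concerned; neither monotonicity in `ε, γ` nor the axioms of a norm
are asked for. -/
def DominatesData (c Γ : ℝ) (N : ℝ → ℝ → (ℝ → ℝ → ℂ) → ℝ) : Prop :=
  ∀ ε γ : ℝ, 0 < ε → ε ^ 2 / 4 ≤ γ → γ ≤ Γ →
    ∀ g : ℝ → ℝ → ℂ, Continuous (fun p : ℝ × ℝ => g p.1 p.2) →
      max (rectNorm ε γ g) (lineNorm ε γ g) ≤ c * N ε γ g

/-- The norm `sup_{|η| ≤ γ} ‖g(·, η)‖_{L¹[-ε,ε]}`. -/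
def supNorm (ε γ : ℝ) (g : ℝ → ℝ → ℂ) : ℝ :=
  sSup ((fun η => lineNorm ε η g) '' Icc (-γ) γ)

theorem dominatesData_max (Γ : ℝ) :
    DominatesData 1 Γ (fun ε γ g => max (rectNorm ε γ g) (lineNorm ε γ g)) := by
  intro ε γ _ _ _ g _
  simp

theorem dominatesData_supNorm (Γ : ℝ) :
    DominatesData (max 1 (2 * Γ)) Γ supNorm := by
  intro ε γ hε hεγ hγΓ g hg
  have hγ : 0 < γ := lt_of_lt_of_le (by positivity) hεγ
  have hcont : Continuous (fun η => lineNorm ε η g) := by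
    unfold lineNorm
    exact continuous_parametric_integral_of_continuous
      (f := fun η ξ => ‖g ξ η‖) (hg.norm.comp continuous_swap) isCompact_Icc
  have hbdd : BddAbove ((fun η => lineNorm ε η g) '' Icc (-γ) γ) :=
    (isCompact_Icc.image hcont).bddAbove
  have hle : ∀ η ∈ Icc (-γ) γ, lineNorm ε η g ≤ supNorm ε γ g := fun η hη =>
    le_csSup hbdd ⟨η, hη, rfl⟩
  have hline : lineNorm ε γ g ≤ supNorm ε γ g := hle γ ⟨by linarith, le_rfl⟩
  have h0 : 0 ≤ supNorm ε γ g :=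
    le_trans (by unfold lineNorm; positivity) hline
  have hrect : rectNorm ε γ g ≤ 2 * γ * supNorm ε γ g := by
    have hint : IntegrableOn (fun p : ℝ × ℝ => ‖g p.1 p.2‖) (Icc (-ε) ε ×ˢ Ioo (-γ) γ)
        (volume.prod volume) :=
      ((hg.norm.continuousOn).integrableOn_compact
        (isCompact_Icc.prod isCompact_Icc)).mono_set
        (prod_mono_right Ioo_subset_Icc_self)
    have h1 : rectNorm ε γ g = ∫ η in Ioo (-γ) γ, lineNorm ε η g := by
      unfold rectNorm lineNorm
      rw [IntegrableOn, ← Measure.prod_restrict] at hint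
      rw [Measure.volume_eq_prod, ← Measure.prod_restrict]
      exact integral_prod_symm _ hint
    have h2 : ∫ η in Ioo (-γ) γ, lineNorm ε η g ≤ ∫ _η in Ioo (-γ) γ, supNorm ε γ g := by
      refine setIntegral_mono_on ?_ ?_ measurableSet_Ioo
        (fun η hη => hle η (Ioo_subset_Icc_self hη))
      · exact (hcont.continuousOn.integrableOn_compact isCompact_Icc).mono_set
          Ioo_subset_Icc_self
      · simp
    have h3 : ∫ _η in Ioo (-γ) γ, supNorm ε γ g = 2 * γ * supNorm ε γ g := by
      rw [setIntegral_const, smul_eq_mul, Real.volume_real_Ioo_of_le (by linarith)]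
      ring
    rw [h1]
    exact h2.trans h3.le
  refine max_le ?_ ?_
  · refine hrect.trans (mul_le_mul_of_nonneg_right ?_ h0)
    exact le_trans (by linarith) (le_max_right _ _)
  · refine hline.trans ?_
    exact le_mul_of_one_le_left h0 (le_max_left _ _)

end LocalRadon

end

/-! Write `R_j` for the transform of `f` with weight `x^j m`. After the substitution `y = ξx + γ`
and Fubini, the `k`-th moment of the mean is the pairing of `ϕ_ε` with `R_k(·, γ)` on `[-ε, ε]`. The
point is to replace `R_k` by the data `R_0` at a cost of order `k!^(σ-1)`.

The weight equation gives `∂_ξ R_j - ∂_η R_{j+1} = a R_{j+1} + b R_j`, in weak form only, since `f`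
is merely continuous (`weak_transport_weightedRadon`). Put `A(ξ,η) = ∫_γ^η a(ξ,τ) dτ` and `β = b +
∂_ξ A`. Testing with `e^A w` on the rectangle `|ξ| ≤ ε`, `|η| ≤ γ` removes `a`: the pairing of `R_j`
with `e^A (∂_ξ + β) w`, minus that of `R_{j+1}` with `e^A ∂_η w`, equals minus the pairing of
`R_{j+1}(·, γ)` with `w(·, γ)` (`transport_step`). There is no other boundary term: `w` vanishes at
`ξ = ±ε`, and lines with `η = -γ` do not rise above the parabola because `ε²/4 ≤ γ`.

Start from `W_0 = ϕ_ε(ξ)` and let `W_{l+1}` be the primitive in `η` of `(∂_ξ + β) W_l` that vanishes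
at `η = γ`. The identities then telescope (`integral_jetOp_iter_eq`), and moment `k + 1` becomes, up
to sign, the integral of `e^A (∂_ξ + β) W_k` against `R_0` over the rectangle.

This kernel carries `k + 1` derivatives in `ξ`, which cost `(k+1)!^σ` by the Gevrey bounds, and `k`
integrations in `η`, which gain `1/k!` (`abs_jetIter_le`). The quotient is `(k+1)!^(σ-1)` up to a
geometric factor. No `η`-derivatives of `a`, `b` are needed, so only jets in `ξ` are tracked. -/

namespace LocalRadon

/-! ### Differentiation and interchange of parametric integrals -/

section Calculus

variable {E : Type*} [NormedAddCommGroup E] [NormedSpace ℝ E]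

/-- The chain rule along a curve, for a function of two variables with continuous partial
derivatives. -/
theorem hasDerivAt_comp_of_partials {G G₁ G₂ : ℝ → ℝ → E}
    (h₁ : ∀ ξ η, HasDerivAt (fun s => G s η) (G₁ ξ η) ξ)
    (h₂ : ∀ ξ η, HasDerivAt (fun s => G ξ s) (G₂ ξ η) η)
    (c₁ : Continuous fun p : ℝ × ℝ => G₁ p.1 p.2) (c₂ : Continuous fun p : ℝ × ℝ => G₂ p.1 p.2)
    {u v : ℝ → ℝ} {u' v' t : ℝ} (hu : HasDerivAt u u' t) (hv : HasDerivAt v v' t) :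
    HasDerivAt (fun s => G (u s) (v s)) (u' • G₁ (u t) (v t) + v' • G₂ (u t) (v t)) t := by
  have key := hasStrictFDerivAt_uncurry_coprod (𝕜 := ℝ) (u := (u t, v t)) (f := G)
    (f₁ := fun ξ η => ContinuousLinearMap.toSpanSingleton ℝ (G₁ ξ η))
    (f₂ := fun ξ η => ContinuousLinearMap.toSpanSingleton ℝ (G₂ ξ η))
    (Filter.Eventually.of_forall fun p => (h₁ p.1 p.2).hasFDerivAt)
    (Filter.Eventually.of_forall fun p => (h₂ p.1 p.2).hasFDerivAt)
    (((ContinuousLinearMap.toSpanSingletonCLE (𝕜 := ℝ) (E := E)).continuous.comp c₁).continuousAt)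
    (((ContinuousLinearMap.toSpanSingletonCLE (𝕜 := ℝ) (E := E)).continuous.comp c₂).continuousAt)
  have := key.hasFDerivAt.comp_hasDerivAt t (hu.prodMk hv)
  simpa [Function.HasUncurry.uncurry, Function.comp_def] using this

theorem hasDerivAt_intervalIntegral_param {F F' : ℝ → ℝ → E}
    (c : Continuous fun p : ℝ × ℝ => F p.1 p.2) (c' : Continuous fun p : ℝ × ℝ => F' p.1 p.2)
    (h : ∀ ξ t, HasDerivAt (fun s => F s t) (F' ξ t) ξ) (a b ξ : ℝ) :
    HasDerivAt (fun s => ∫ t in a..b, F s t) (∫ t in a..b, F' ξ t) ξ := by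
  obtain ⟨M, hM⟩ := ((isCompact_Icc (a := ξ - 1) (b := ξ + 1)).prod
    (isCompact_uIcc (a := a) (b := b))).exists_bound_of_continuousOn c'.continuousOn
  refine (intervalIntegral.hasDerivAt_integral_of_dominated_loc_of_deriv_le (F' := F')
    (bound := fun _ => M) (Icc_mem_nhds (by linarith : ξ - 1 < ξ) (by linarith : ξ < ξ + 1))
    (Filter.Eventually.of_forall fun s => ?_) ?_ ?_ ?_ (by simp) ?_).2
  · exact (c.comp (by fun_prop : Continuous fun t : ℝ => (s, t))).aestronglyMeasurable
  · exact (c.comp (by fun_prop : Continuous fun t : ℝ => (ξ, t))).intervalIntegrable _ _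
  · exact (c'.comp (by fun_prop : Continuous fun t : ℝ => (ξ, t))).aestronglyMeasurable
  · exact Filter.Eventually.of_forall fun t ht s hs => hM (s, t) ⟨hs, uIoc_subset_uIcc ht⟩
  · exact Filter.Eventually.of_forall fun t _ s _ => h s t

/-- Leibniz' rule for a product of a function of `x ξ + η` that is merely continuous and a
continuously differentiable function of `(ξ, η)`. -/
theorem hasDerivAt_integral_shear {h : ℝ → ℂ} (hh : Continuous h) {G G₁ G₂ : ℝ → ℝ → ℂ}
    (h₁ : ∀ ξ η, HasDerivAt (fun s => G s η) (G₁ ξ η) ξ)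
    (h₂ : ∀ ξ η, HasDerivAt (fun s => G ξ s) (G₂ ξ η) η)
    (c : Continuous fun p : ℝ × ℝ => G p.1 p.2)
    (c₁ : Continuous fun p : ℝ × ℝ => G₁ p.1 p.2) (c₂ : Continuous fun p : ℝ × ℝ => G₂ p.1 p.2)
    (x α β ξ : ℝ) :
    HasDerivAt (fun s => ∫ η in α..β, h (s * x + η) * G s η)
      ((∫ η in α..β, h (ξ * x + η) * (G₁ ξ η - x * G₂ ξ η))
        + x * (h (ξ * x + β) * G ξ β - h (ξ * x + α) * G ξ α)) ξ := by
  -- In the variable `y = s x + η` the factor `h` no longer depends on `s`, so the derivative falls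
  -- on `G` and on the limits of integration only.
  set K : ℝ → ℝ → ℂ := fun s y => h y * G s (y - s * x) with hK
  set K₁ : ℝ → ℝ → ℂ := fun s y => h y * (G₁ s (y - s * x) - x * G₂ s (y - s * x)) with hK₁
  have cK : Continuous fun p : ℝ × ℝ => K p.1 p.2 :=
    (hh.comp continuous_snd).mul (c.comp (by fun_prop :
      Continuous fun p : ℝ × ℝ => (p.1, p.2 - p.1 * x)))
  have cK₁ : Continuous fun p : ℝ × ℝ => K₁ p.1 p.2 :=
    (hh.comp continuous_snd).mul ((c₁.comp (by fun_prop :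
      Continuous fun p : ℝ × ℝ => (p.1, p.2 - p.1 * x))).sub
      (continuous_const.mul (c₂.comp (by fun_prop :
      Continuous fun p : ℝ × ℝ => (p.1, p.2 - p.1 * x)))))
  have dK : ∀ s y, HasDerivAt (fun s => K s y) (K₁ s y) s := by
    intro s y
    have hv : HasDerivAt (fun s : ℝ => y - s * x) (-x) s := by
      simpa using ((hasDerivAt_id s).mul_const x).const_sub y
    have := (hasDerivAt_comp_of_partials h₁ h₂ c₁ c₂ (hasDerivAt_id s) hv).const_mul (h y)
    refine this.congr_deriv ?_
    simp [hK₁, sub_eq_add_neg]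
  have cS₁ : Continuous fun p : ℝ × ℝ => ∫ y in (0 : ℝ)..p.2, K₁ p.1 y :=
    intervalIntegral.continuous_parametric_intervalIntegral_of_continuous
      (f := fun p : ℝ × ℝ => K₁ p.1)
      (cK₁.comp (by fun_prop : Continuous fun q : (ℝ × ℝ) × ℝ => (q.1.1, q.2))) continuous_snd
  have ccK : ∀ s, Continuous (K s) := fun s =>
    cK.comp (by fun_prop : Continuous fun t : ℝ => (s, t))
  have dS : ∀ δ : ℝ, HasDerivAt (fun s => ∫ y in (0 : ℝ)..(s * x + δ), K s y)
      ((∫ y in (0 : ℝ)..(ξ * x + δ), K₁ ξ y) + x * K ξ (ξ * x + δ)) ξ := by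
    intro δ
    have hv : HasDerivAt (fun s : ℝ => s * x + δ) x ξ := by
      simpa using ((hasDerivAt_id ξ).mul_const x).add_const δ
    have := hasDerivAt_comp_of_partials (G := fun s u => ∫ y in (0 : ℝ)..u, K s y)
      (G₁ := fun s u => ∫ y in (0 : ℝ)..u, K₁ s y) (G₂ := K)
      (fun s u => hasDerivAt_intervalIntegral_param cK cK₁ dK 0 u s)
      (fun s u => (ccK s).integral_hasStrictDerivAt 0 u |>.hasDerivAt) cS₁ cK
      (hasDerivAt_id ξ) hv
    simpa using this
  have shift : ∀ L : ℝ → ℝ → ℂ, (∀ s, Continuous (L s)) → ∀ s,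
      (∫ η in α..β, L s (s * x + η)) = (∫ y in (0 : ℝ)..(s * x + β), L s y)
        - ∫ y in (0 : ℝ)..(s * x + α), L s y := by
    intro L cL s
    rw [intervalIntegral.integral_comp_add_left (fun y => L s y) (s * x),
      intervalIntegral.integral_interval_sub_left] <;>
    exact (cL s).intervalIntegrable _ _
  have e₀ : (fun s => ∫ η in α..β, h (s * x + η) * G s η) = fun s =>
      (∫ y in (0 : ℝ)..(s * x + β), K s y) - ∫ y in (0 : ℝ)..(s * x + α), K s y := by
    funext s
    rw [← shift K ccK s]
    simp [hK]
  rw [e₀]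
  refine ((dS β).sub (dS α)).congr_deriv ?_
  have e₁ := shift K₁ (fun s => cK₁.comp (by fun_prop : Continuous fun t : ℝ => (s, t))) ξ
  have e₂ : (∫ η in α..β, K₁ ξ (ξ * x + η))
      = ∫ η in α..β, h (ξ * x + η) * (G₁ ξ η - x * G₂ ξ η) := by simp [hK₁]
  rw [← e₂, e₁]
  simp only [hK, add_sub_cancel_left]
  ring

/-- The integrated form of `hasDerivAt_integral_shear`, when all boundary terms but one vanish. -/
theorem integral_shear_eq {h : ℝ → ℂ} (hh : Continuous h) {G G₁ G₂ : ℝ → ℝ → ℂ}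
    (h₁ : ∀ ξ η, HasDerivAt (fun s => G s η) (G₁ ξ η) ξ)
    (h₂ : ∀ ξ η, HasDerivAt (fun s => G ξ s) (G₂ ξ η) η)
    (c : Continuous fun p : ℝ × ℝ => G p.1 p.2)
    (c₁ : Continuous fun p : ℝ × ℝ => G₁ p.1 p.2) (c₂ : Continuous fun p : ℝ × ℝ => G₂ p.1 p.2)
    {x ε γ : ℝ} (hε : 0 ≤ ε) (hleft : ∀ η, G (-ε) η = 0) (hright : ∀ η, G ε η = 0)
    (hlow : ∀ ξ ∈ Icc (-ε) ε, h (ξ * x - γ) = 0) :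
    (∫ ξ in (-ε)..ε, ∫ η in (-γ)..γ, h (ξ * x + η) * (G₁ ξ η - x * G₂ ξ η))
      = -(x * ∫ ξ in (-ε)..ε, h (ξ * x + γ) * G ξ γ) := by
  have cI : Continuous fun ξ => ∫ η in (-γ)..γ, h (ξ * x + η) * (G₁ ξ η - x * G₂ ξ η) := by
    apply intervalIntegral.continuous_parametric_intervalIntegral_of_continuous'
    exact (hh.comp (by fun_prop)).mul (c₁.sub (continuous_const.mul c₂))
  have cB : ∀ δ : ℝ, Continuous fun ξ => h (ξ * x + δ) * G ξ δ := fun δ =>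
    (hh.comp (by fun_prop)).mul (c.comp (by fun_prop : Continuous fun ξ : ℝ => (ξ, δ)))
  have cB' : Continuous fun ξ => x * (h (ξ * x + γ) * G ξ γ - h (ξ * x + -γ) * G ξ (-γ)) :=
    continuous_const.mul ((cB γ).sub (cB (-γ)))
  have key := intervalIntegral.integral_eq_sub_of_hasDerivAt (a := -ε) (b := ε)
    (fun ξ _ => hasDerivAt_integral_shear hh h₁ h₂ c c₁ c₂ x (-γ) γ ξ)
    ((cI.add cB').intervalIntegrable _ _)
  rw [intervalIntegral.integral_add (cI.intervalIntegrable _ _) (cB'.intervalIntegrable _ _)] at key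
  have e : (∫ ξ in (-ε)..ε, x * (h (ξ * x + γ) * G ξ γ - h (ξ * x + -γ) * G ξ (-γ)))
      = x * ∫ ξ in (-ε)..ε, h (ξ * x + γ) * G ξ γ := by
    rw [← intervalIntegral.integral_const_mul]
    refine intervalIntegral.integral_congr fun ξ hξ => ?_
    rw [uIcc_of_le (by linarith)] at hξ
    simp [← sub_eq_add_neg, hlow ξ hξ]
  rw [e] at key
  simp only [hleft, hright, mul_zero, intervalIntegral.integral_zero, sub_zero] at key
  exact eq_neg_of_add_eq_zero_left key

theorem integral_swap_of_continuous {F : ℝ → ℝ → ℂ} (c : Continuous fun p : ℝ × ℝ => F p.1 p.2)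
    (a b a' b' : ℝ) :
    (∫ x in a..b, ∫ y in a'..b', F x y) = ∫ y in a'..b', ∫ x in a..b, F x y :=
  intervalIntegral_intervalIntegral_swap
    ((c.continuousOn.integrableOn_compact (isCompact_uIcc.prod isCompact_uIcc)).mono_set
      (prod_mono uIoc_subset_uIcc uIoc_subset_uIcc))

theorem integral_rotate {T : ℝ → ℝ → ℝ → ℂ}
    (c : Continuous fun p : ℝ × ℝ × ℝ => T p.1 p.2.1 p.2.2) (a₁ b₁ a₂ b₂ a₃ b₃ : ℝ) :
    (∫ ξ in a₁..b₁, ∫ η in a₂..b₂, ∫ x in a₃..b₃, T ξ η x)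
      = ∫ x in a₃..b₃, ∫ ξ in a₁..b₁, ∫ η in a₂..b₂, T ξ η x := by
  have e : ∀ ξ, (∫ η in a₂..b₂, ∫ x in a₃..b₃, T ξ η x) = ∫ x in a₃..b₃, ∫ η in a₂..b₂, T ξ η x :=
    fun ξ => integral_swap_of_continuous (c.comp (by fun_prop : Continuous fun p : ℝ × ℝ => (ξ, p))) _ _ _ _
  simp only [e]
  refine integral_swap_of_continuous (F := fun ξ x => ∫ η in a₂..b₂, T ξ η x) ?_ _ _ _ _
  apply intervalIntegral.continuous_parametric_intervalIntegral_of_continuous'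
    (f := fun (p : ℝ × ℝ) η => T p.1 η p.2)
  exact c.comp (by fun_prop : Continuous fun q : (ℝ × ℝ) × ℝ => (q.1.1, q.2, q.1.2))

end Calculus

/-! ### Partial derivatives of smooth functions -/

theorem hasDerivAt_fst_of_contDiff {u : ℝ → ℝ → ℝ}
    (hu : ContDiff ℝ ∞ fun p : ℝ × ℝ => u p.1 p.2) (ξ η : ℝ) :
    HasDerivAt (fun s => u s η) (deriv (fun s => u s η) ξ) ξ := by
  have : ContDiff ℝ ∞ fun s => u s η := hu.comp (by fun_prop : ContDiff ℝ ∞ fun s : ℝ => (s, η))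
  exact (this.differentiable (by simp) ξ).hasDerivAt

theorem hasDerivAt_snd_of_contDiff {u : ℝ → ℝ → ℝ}
    (hu : ContDiff ℝ ∞ fun p : ℝ × ℝ => u p.1 p.2) (ξ η : ℝ) :
    HasDerivAt (fun s => u ξ s) (deriv (fun s => u ξ s) η) η := by
  have : ContDiff ℝ ∞ fun s => u ξ s := hu.comp (by fun_prop : ContDiff ℝ ∞ fun s : ℝ => (ξ, s))
  exact (this.differentiable (by simp) η).hasDerivAt

theorem contDiff_deriv_fst {u : ℝ → ℝ → ℝ} (hu : ContDiff ℝ ∞ fun p : ℝ × ℝ => u p.1 p.2) :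
    ContDiff ℝ ∞ fun p : ℝ × ℝ => deriv (fun s => u s p.2) p.1 := by
  have e : (fun p : ℝ × ℝ => deriv (fun s => u s p.2) p.1)
      = fun p => fderiv ℝ (fun p : ℝ × ℝ => u p.1 p.2) p (1, 0) := by
    funext p
    exact ((hu.differentiable (by simp) p).hasFDerivAt.comp_hasDerivAt p.1
      ((hasDerivAt_id p.1).prodMk (hasDerivAt_const p.1 p.2))).deriv
  rw [e]
  exact (hu.fderiv_right (m := ∞) (by simp)).clm_apply contDiff_const

theorem contDiff_deriv_snd {u : ℝ → ℝ → ℝ} (hu : ContDiff ℝ ∞ fun p : ℝ × ℝ => u p.1 p.2) :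
    ContDiff ℝ ∞ fun p : ℝ × ℝ => deriv (fun s => u p.1 s) p.2 := by
  have := contDiff_deriv_fst (u := fun η ξ => u ξ η)
    (hu.comp (by fun_prop : ContDiff ℝ ∞ fun p : ℝ × ℝ => (p.2, p.1)))
  exact this.comp (by fun_prop : ContDiff ℝ ∞ fun p : ℝ × ℝ => (p.2, p.1))

/-! ### The weighted Radon transform of functions supported above the parabola -/

/-- The support condition gives vanishing strictly below the parabola; continuity adds the parabola
itself. -/
theorem eq_zero_of_le_sq {f : ℝ → ℝ → ℂ} (hf : Continuous fun p : ℝ × ℝ => f p.1 p.2)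
    (hs : tsupport (fun p : ℝ × ℝ => f p.1 p.2) ⊆ {p : ℝ × ℝ | p.1 ^ 2 ≤ p.2})
    (x y : ℝ) (hy : y ≤ x ^ 2) : f x y = 0 := by
  have h₀ : EqOn (f x) (fun _ => 0) (Iio (x ^ 2)) := by
    intro t ht
    by_contra h
    have : (x, t) ∈ {p : ℝ × ℝ | p.1 ^ 2 ≤ p.2} := hs (subset_tsupport _ h)
    exact absurd (show x ^ 2 ≤ t from this) (not_le.2 ht)
  have := h₀.closure (hf.comp (by fun_prop : Continuous fun t : ℝ => (x, t))) continuous_const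
  rw [closure_Iio] at this
  exact this hy

/-- Lines with bounded slope and intercept meet the region above the parabola in a bounded range of
`x`. All integrals in `x` can thus be taken over one compact interval, where Fubini and continuity
are immediate. -/
theorem abs_lt_of_sq_lt {x ξ η A H : ℝ} (hξ : |ξ| ≤ A) (hη : |η| ≤ H) (h : x ^ 2 < ξ * x + η) :
    |x| < A + H + 1 := by
  by_contra! hx
  have hA : 0 ≤ A := (abs_nonneg _).trans hξ
  have hH : 0 ≤ H := (abs_nonneg _).trans hη
  have h₁ : ξ * x ≤ A * |x| := by
    calc ξ * x ≤ |ξ * x| := le_abs_self _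
      _ = |ξ| * |x| := abs_mul _ _
      _ ≤ A * |x| := by gcongr
  have h₂ : η ≤ H := (le_abs_self _).trans hη
  have h₃ : |x| ^ 2 = x ^ 2 := sq_abs x
  nlinarith [mul_le_mul_of_nonneg_left hx (abs_nonneg x), abs_nonneg x]

section Radon

variable {f : ℝ → ℝ → ℂ} (hf : Continuous fun p : ℝ × ℝ => f p.1 p.2)
  (hf₀ : ∀ x y, y ≤ x ^ 2 → f x y = 0)

include hf₀ in
theorem eq_zero_of_le_abs {x ξ η A H : ℝ} (hξ : |ξ| ≤ A) (hη : |η| ≤ H) (hx : A + H + 1 ≤ |x|) :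
    f x (ξ * x + η) = 0 := by
  by_contra h
  exact absurd (abs_lt_of_sq_lt hξ hη (not_le.1 fun h' => h (hf₀ _ _ h'))) (not_lt.2 hx)

include hf₀ in
theorem weightedRadon_eq_intervalIntegral (n : ℝ → ℝ → ℝ → ℝ) {ξ η A H : ℝ} (hξ : |ξ| ≤ A)
    (hη : |η| ≤ H) :
    weightedRadon n f ξ η
      = ∫ x in (-(A + H + 1))..(A + H + 1), f x (ξ * x + η) * (n x ξ η : ℂ) := by
  refine (intervalIntegral.integral_eq_integral_of_support_subset fun x hx => ?_).symm
  have : |x| < A + H + 1 := by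
    by_contra! h
    exact hx (by simp [eq_zero_of_le_abs hf₀ hξ hη h])
  exact ⟨(abs_lt.1 this).1, (abs_lt.1 this).2.le⟩

include hf hf₀ in
theorem continuous_weightedRadon {n : ℝ → ℝ → ℝ → ℝ}
    (hn : Continuous fun p : ℝ × ℝ × ℝ => n p.1 p.2.1 p.2.2) :
    Continuous fun p : ℝ × ℝ => weightedRadon n f p.1 p.2 := by
  rw [continuous_iff_continuousAt]
  intro p
  set R : ℝ := |p.1| + 1 + (|p.2| + 1) + 1
  have c : Continuous fun p : ℝ × ℝ =>
      ∫ x in (-R)..R, f x (p.1 * x + p.2) * (n x p.1 p.2 : ℂ) := by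
    apply intervalIntegral.continuous_parametric_intervalIntegral_of_continuous'
      (f := fun (p : ℝ × ℝ) x => f x (p.1 * x + p.2) * (n x p.1 p.2 : ℂ))
    exact (hf.comp (by fun_prop : Continuous fun q : (ℝ × ℝ) × ℝ =>
      (q.2, q.1.1 * q.2 + q.1.2))).mul (Complex.continuous_ofReal.comp
      (hn.comp (by fun_prop : Continuous fun q : (ℝ × ℝ) × ℝ => (q.2, q.1.1, q.1.2))))
  refine c.continuousAt.congr ?_
  have h₁ : ∀ᶠ q : ℝ × ℝ in nhds p, |q.1| < |p.1| + 1 :=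
    (continuous_fst.abs.tendsto p).eventually (Iio_mem_nhds (by simp))
  have h₂ : ∀ᶠ q : ℝ × ℝ in nhds p, |q.2| < |p.2| + 1 :=
    (continuous_snd.abs.tendsto p).eventually (Iio_mem_nhds (by simp))
  filter_upwards [h₁, h₂] with q hq₁ hq₂
  exact (weightedRadon_eq_intervalIntegral hf₀ n hq₁.le hq₂.le).symm

/-- The weight `x ^ j * m`. -/
def powWeight (j : ℕ) (m : ℝ → ℝ → ℝ → ℝ) (x ξ η : ℝ) : ℝ := x ^ j * m x ξ η

theorem continuous_powWeight (j : ℕ) {m : ℝ → ℝ → ℝ → ℝ}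
    (hm : Continuous fun p : ℝ × ℝ × ℝ => m p.1 p.2.1 p.2.2) :
    Continuous fun p : ℝ × ℝ × ℝ => powWeight j m p.1 p.2.1 p.2.2 :=
  (continuous_fst.pow j).mul hm

include hf hf₀ in
/-- The weak form of `∂_ξ R_{x^j m} f - ∂_η R_{x^{j+1} m} f = a R_{x^{j+1} m} f + b R_{x^j m} f`. -/
theorem weak_transport_weightedRadon {a b : ℝ → ℝ → ℝ}
    (ca : Continuous fun p : ℝ × ℝ => a p.1 p.2) (cb : Continuous fun p : ℝ × ℝ => b p.1 p.2)
    {m : ℝ → ℝ → ℝ → ℝ} (hm : ContDiff ℝ ∞ fun p : ℝ × ℝ × ℝ => m p.1 p.2.1 p.2.2)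
    (hsol : SolvesWeightEquation a b m) {X X₁ X₂ : ℝ → ℝ → ℝ}
    (h₁ : ∀ ξ η, HasDerivAt (fun s => X s η) (X₁ ξ η) ξ)
    (h₂ : ∀ ξ η, HasDerivAt (fun s => X ξ s) (X₂ ξ η) η)
    (c : Continuous fun p : ℝ × ℝ => X p.1 p.2)
    (c₁ : Continuous fun p : ℝ × ℝ => X₁ p.1 p.2) (c₂ : Continuous fun p : ℝ × ℝ => X₂ p.1 p.2)
    {ε γ : ℝ} (hε : 0 ≤ ε) (hγ : ε ^ 2 / 4 ≤ γ)
    (hleft : ∀ η, X (-ε) η = 0) (hright : ∀ η, X ε η = 0) (j : ℕ) :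
    (∫ ξ in (-ε)..ε, ∫ η in (-γ)..γ,
        (((X₁ ξ η + b ξ η * X ξ η : ℝ) : ℂ) * weightedRadon (powWeight j m) f ξ η
        + ((a ξ η * X ξ η - X₂ ξ η : ℝ) : ℂ) * weightedRadon (powWeight (j + 1) m) f ξ η))
      = -∫ ξ in (-ε)..ε, (X ξ γ : ℂ) * weightedRadon (powWeight (j + 1) m) f ξ γ := by
  have hγ₀ : 0 ≤ γ := le_trans (by positivity) hγ
  set R : ℝ := ε + γ + 1
  set T : ℝ → ℝ → ℝ → ℂ := fun ξ η x => f x (ξ * x + η) *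
    ((x ^ j * ((X₁ ξ η + b ξ η * X ξ η + x * (a ξ η * X ξ η - X₂ ξ η)) * m x ξ η) : ℝ) : ℂ)
    with hT
  have hmc := hm.continuous
  have p₁ : Continuous fun q : ℝ × ℝ × ℝ => (q.1, q.2.1) := by fun_prop
  have cf : Continuous fun q : ℝ × ℝ × ℝ => f q.2.2 (q.1 * q.2.2 + q.2.1) :=
    hf.comp (by fun_prop : Continuous fun q : ℝ × ℝ × ℝ => (q.2.2, q.1 * q.2.2 + q.2.1))
  have cm : Continuous fun q : ℝ × ℝ × ℝ => m q.2.2 q.1 q.2.1 :=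
    hmc.comp (by fun_prop : Continuous fun q : ℝ × ℝ × ℝ => (q.2.2, q.1, q.2.1))
  have cX := c.comp p₁
  have cX₁ := c₁.comp p₁
  have cX₂ := c₂.comp p₁
  have cca := ca.comp p₁
  have ccb := cb.comp p₁
  simp only [Function.comp_def] at cX cX₁ cX₂ cca ccb
  have cT : Continuous fun q : ℝ × ℝ × ℝ => T q.1 q.2.1 q.2.2 :=
    cf.mul (Complex.continuous_ofReal.comp (by fun_prop))
  have slice : ∀ (i : ℕ) (ξ η : ℝ) (z : ℂ), IntervalIntegrable (fun x =>
      z * (f x (ξ * x + η) * (powWeight i m x ξ η : ℂ))) volume (-R) R := fun i ξ η z =>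
    Continuous.intervalIntegrable (continuous_const.mul ((cf.comp (by fun_prop : Continuous fun x : ℝ => (ξ, η, x))).mul
      (Complex.continuous_ofReal.comp ((continuous_id.pow i).mul
        (cm.comp (by fun_prop : Continuous fun x : ℝ => (ξ, η, x))))))) _ _
  have eL : (∫ ξ in (-ε)..ε, ∫ η in (-γ)..γ,
        (((X₁ ξ η + b ξ η * X ξ η : ℝ) : ℂ) * weightedRadon (powWeight j m) f ξ η
        + ((a ξ η * X ξ η - X₂ ξ η : ℝ) : ℂ) * weightedRadon (powWeight (j + 1) m) f ξ η))
      = ∫ ξ in (-ε)..ε, ∫ η in (-γ)..γ, ∫ x in (-R)..R, T ξ η x := by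
    refine intervalIntegral.integral_congr fun ξ hξ => intervalIntegral.integral_congr fun η hη => ?_
    rw [uIcc_of_le (by linarith)] at hξ hη
    rw [weightedRadon_eq_intervalIntegral hf₀ _ (abs_le.2 hξ) (abs_le.2 hη),
      weightedRadon_eq_intervalIntegral hf₀ _ (abs_le.2 hξ) (abs_le.2 hη),
      ← intervalIntegral.integral_const_mul, ← intervalIntegral.integral_const_mul,
      ← intervalIntegral.integral_add (slice _ _ _ _) (slice _ _ _ _)]
    refine intervalIntegral.integral_congr fun x _ => ?_
    simp only [hT, powWeight]
    push_cast
    ring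
  have eR : (∫ ξ in (-ε)..ε, (X ξ γ : ℂ) * weightedRadon (powWeight (j + 1) m) f ξ γ)
      = ∫ x in (-R)..R, ∫ ξ in (-ε)..ε,
          (X ξ γ : ℂ) * (f x (ξ * x + γ) * (powWeight (j + 1) m x ξ γ : ℂ)) := by
    rw [← integral_swap_of_continuous (F := fun ξ x =>
      (X ξ γ : ℂ) * (f x (ξ * x + γ) * (powWeight (j + 1) m x ξ γ : ℂ)))]
    · refine intervalIntegral.integral_congr fun ξ hξ => ?_
      rw [uIcc_of_le (by linarith)] at hξ
      rw [weightedRadon_eq_intervalIntegral hf₀ _ (abs_le.2 hξ) (abs_of_nonneg hγ₀).le,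
        ← intervalIntegral.integral_const_mul]
    · have p₂ : Continuous fun q : ℝ × ℝ => (q.1, γ, q.2) := by fun_prop
      exact (Complex.continuous_ofReal.comp (cX.comp p₂)).mul ((cf.comp p₂).mul
        (Complex.continuous_ofReal.comp ((continuous_snd.pow (j + 1)).mul (cm.comp p₂))))
  rw [eL, eR, integral_rotate cT, ← intervalIntegral.integral_neg]
  refine intervalIntegral.integral_congr fun x _ => ?_
  have hmx : ContDiff ℝ ∞ fun p : ℝ × ℝ => m x p.1 p.2 :=
    hm.comp (by fun_prop : ContDiff ℝ ∞ fun p : ℝ × ℝ => (x, p.1, p.2))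
  have cmx := hmx.continuous
  have cmx₁ := (contDiff_deriv_fst hmx).continuous
  have cmx₂ := (contDiff_deriv_snd hmx).continuous
  have key := integral_shear_eq (h := f x) (hf.comp (by fun_prop : Continuous fun y : ℝ => (x, y)))
    (G := fun ξ η => ((x ^ j * (X ξ η * m x ξ η) : ℝ) : ℂ))
    (G₁ := fun ξ η => ((x ^ j * (X₁ ξ η * m x ξ η + X ξ η * deriv (fun s => m x s η) ξ) : ℝ) : ℂ))
    (G₂ := fun ξ η => ((x ^ j * (X₂ ξ η * m x ξ η + X ξ η * deriv (fun s => m x ξ s) η) : ℝ) : ℂ))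
    (fun ξ η => (((h₁ ξ η).mul (hasDerivAt_fst_of_contDiff hmx ξ η)).const_mul _).ofReal_comp)
    (fun ξ η => (((h₂ ξ η).mul (hasDerivAt_snd_of_contDiff hmx ξ η)).const_mul _).ofReal_comp)
    (Complex.continuous_ofReal.comp (by fun_prop)) (Complex.continuous_ofReal.comp (by fun_prop))
    (Complex.continuous_ofReal.comp (by fun_prop)) (x := x) (γ := γ) hε
    (by simp [hleft]) (by simp [hright]) (fun ξ hξ => hf₀ _ _ (by
      -- On the lower edge, `x² - ξx + γ = (x - ξ/2)² + (γ - ξ²/4) ≥ 0`.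
      have : ξ ^ 2 ≤ ε ^ 2 := sq_le_sq' hξ.1 hξ.2
      nlinarith [sq_nonneg (x - ξ / 2)]))
  have e₁ : (∫ ξ in (-ε)..ε, ∫ η in (-γ)..γ, T ξ η x) = ∫ ξ in (-ε)..ε, ∫ η in (-γ)..γ,
      f x (ξ * x + η) *
        (((x ^ j * (X₁ ξ η * m x ξ η + X ξ η * deriv (fun s => m x s η) ξ) : ℝ) : ℂ)
        - x * ((x ^ j * (X₂ ξ η * m x ξ η + X ξ η * deriv (fun s => m x ξ s) η) : ℝ) : ℂ)) := by
    refine intervalIntegral.integral_congr fun ξ _ => intervalIntegral.integral_congr fun η _ => ?_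
    simp only [hT]
    rw [← Complex.ofReal_mul, ← Complex.ofReal_sub]
    congr 2
    -- The weight equation enters here: it replaces `∂_ξ m - x ∂_η m` by `(x a + b) m`.
    linear_combination (-(x ^ j * X ξ η)) * hsol x ξ η
  rw [e₁, key, ← intervalIntegral.integral_const_mul]
  congr 1
  refine intervalIntegral.integral_congr fun ξ _ => ?_
  simp only [powWeight]
  push_cast
  ring

end Radon

/-! ### Moments of the means as integrals of the data on `η = γ` -/

/-- The substitution `y = ξ x + γ` in the definition of the mean. -/
theorem mean_mulWeight_eq {ϕ : ℝ → ℝ} (heven : ∀ t, ϕ (-t) = ϕ t) (f : ℝ → ℝ → ℂ)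
    (m : ℝ → ℝ → ℝ → ℝ) {ε : ℝ} (hε : 0 < ε) (γ : ℝ) {x : ℝ} (hx : x ≠ 0) :
    mean ϕ ε γ (mulWeight f m γ) x
      = ∫ ξ in (-ε)..ε, (dilate ϕ ε ξ : ℂ) * (f x (ξ * x + γ) * (m x ξ γ : ℂ)) := by
  have hx' : 0 < |x| := abs_pos.2 hx
  set g : ℝ → ℂ := fun y => mulWeight f m γ x y * (dilate ϕ (ε * |x|) (γ - y) : ℂ) with hg
  have hset : {y : ℝ | |y - γ| ≤ ε * |x|} = Icc (γ - ε * |x|) (γ + ε * |x|) := by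
    ext y
    simp only [mem_ofPred_eq, mem_Icc, abs_le]
    constructor <;> rintro ⟨h₁, h₂⟩ <;> constructor <;> linarith
  have h₁ : mean ϕ ε γ (mulWeight f m γ) x = ∫ y in (γ - ε * |x|)..(γ + ε * |x|), g y := by
    rw [mean, if_neg hx, hset, integral_Icc_eq_integral_Ioc,
      intervalIntegral.integral_of_le (by nlinarith)]
  have h₂ : (∫ y in (γ - ε * |x|)..(γ + ε * |x|), g y)
      = |x| • ∫ ξ in (-ε)..ε, g (γ + x * ξ) := by
    rcases lt_or_gt_of_ne hx with h | h
    · rw [abs_of_neg h, neg_smul, intervalIntegral.smul_integral_comp_add_mul,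
        ← intervalIntegral.integral_symm]
      congr 1 <;> ring
    · rw [abs_of_pos h, intervalIntegral.smul_integral_comp_add_mul]
      congr 1 <;> ring
  rw [h₁, h₂, ← intervalIntegral.integral_smul]
  refine intervalIntegral.integral_congr fun ξ _ => ?_
  have e₁ : (γ + x * ξ - γ) / x = ξ := by field_simp; ring
  have e₂ : |x| * dilate ϕ (ε * |x|) (γ - (γ + x * ξ)) = dilate ϕ ε ξ := by
    -- The argument is `-sign(x) ξ/ε`; evenness of `ϕ` is needed only for `x > 0`.
    have : ϕ ((γ - (γ + x * ξ)) / (ε * |x|)) = ϕ (ξ / ε) := by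
      rcases lt_or_gt_of_ne hx with h | h
      · rw [abs_of_neg h]
        congr 1
        field_simp
        ring
      · rw [abs_of_pos h, ← heven]
        congr 1
        field_simp
        ring
    rw [dilate, dilate, this]
    field_simp
  simp only [hg, mulWeight, e₁, Complex.real_smul]
  rw [← e₂]
  push_cast
  rw [show ξ * x + γ = γ + x * ξ by ring]
  ring

theorem integrable_and_moment_mean_eq {ϕ : ℝ → ℝ} (hϕ : Continuous ϕ)
    (heven : ∀ t, ϕ (-t) = ϕ t) {f : ℝ → ℝ → ℂ} (hf : Continuous fun p : ℝ × ℝ => f p.1 p.2)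
    (hf₀ : ∀ x y, y ≤ x ^ 2 → f x y = 0) {m : ℝ → ℝ → ℝ → ℝ}
    (hm : Continuous fun p : ℝ × ℝ × ℝ => m p.1 p.2.1 p.2.2) {ε γ : ℝ} (hε : 0 < ε) (hγ : 0 ≤ γ)
    (k : ℕ) :
    Integrable (fun x : ℝ => (x : ℂ) ^ k * mean ϕ ε γ (mulWeight f m γ) x) ∧
      moment k (mean ϕ ε γ (mulWeight f m γ))
        = ∫ ξ in (-ε)..ε, (dilate ϕ ε ξ : ℂ) * weightedRadon (powWeight k m) f ξ γ := by
  set R : ℝ := ε + γ + 1 with hR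
  set T : ℝ → ℝ → ℂ := fun x ξ =>
    (dilate ϕ ε ξ : ℂ) * (f x (ξ * x + γ) * (powWeight k m x ξ γ : ℂ)) with hT
  have cT : Continuous fun p : ℝ × ℝ => T p.1 p.2 := by
    refine (Complex.continuous_ofReal.comp ?_).mul
      ((hf.comp (by fun_prop : Continuous fun p : ℝ × ℝ => (p.1, p.2 * p.1 + γ))).mul
      (Complex.continuous_ofReal.comp ((continuous_powWeight k hm).comp
        (by fun_prop : Continuous fun p : ℝ × ℝ => (p.1, p.2, γ)))))
    unfold dilate
    fun_prop
  set g : ℝ → ℂ := fun x => ∫ ξ in (-ε)..ε, T x ξ with hgdef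
  have cg : Continuous g :=
    intervalIntegral.continuous_parametric_intervalIntegral_of_continuous' cT _ _
  have g₀ : ∀ x, R ≤ |x| → g x = 0 := by
    intro x hx
    rw [hgdef, ← intervalIntegral.integral_zero (a := -ε) (b := ε) (μ := volume)]
    refine intervalIntegral.integral_congr fun ξ hξ => ?_
    rw [uIcc_of_le (by linarith)] at hξ
    simp [hT, eq_zero_of_le_abs hf₀ (abs_le.2 hξ) (abs_of_nonneg hγ).le hx]
  have ae : (fun x : ℝ => (x : ℂ) ^ k * mean ϕ ε γ (mulWeight f m γ) x) =ᵐ[volume] g := by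
    -- The value assigned to the mean at `x = 0` plays no role in the integral.
    have : ∀ᵐ x : ℝ, x ≠ 0 := by simp [ae_iff]
    filter_upwards [this] with x hx
    rw [mean_mulWeight_eq heven f m hε γ hx, hgdef, ← intervalIntegral.integral_const_mul]
    refine intervalIntegral.integral_congr fun ξ _ => ?_
    simp only [hT, powWeight]
    push_cast
    ring
  have ig : Integrable g := by
    refine cg.integrable_of_hasCompactSupport (HasCompactSupport.intro
      (isCompact_Icc (a := -R) (b := R)) fun x hx => g₀ x ?_)
    by_contra! h
    exact hx (abs_le.1 h.le)
  refine ⟨ig.congr ae.symm, ?_⟩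
  have sg : Function.support g ⊆ Ioc (-R) R := fun x hx => by
    have : |x| < R := by
      by_contra! h
      exact hx (g₀ x h)
    exact ⟨(abs_lt.1 this).1, (abs_lt.1 this).2.le⟩
  rw [moment, integral_congr_ae ae,
    ← intervalIntegral.integral_eq_integral_of_support_subset sg, hgdef,
    integral_swap_of_continuous cT]
  refine intervalIntegral.integral_congr fun ξ hξ => ?_
  rw [uIcc_of_le (by linarith)] at hξ
  simp only [hT]
  rw [weightedRadon_eq_intervalIntegral hf₀ _ (abs_le.2 hξ) (abs_of_nonneg hγ).le,
    ← intervalIntegral.integral_const_mul]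

/-! ### Functions with all their derivatives in the first variable -/

/-- `w p` is the `p`-th derivative of `w 0` in the first variable, and all `w p` are jointly
continuous. -/
structure IsJet (w : ℕ → ℝ → ℝ → ℝ) : Prop where
  continuous : ∀ p, Continuous fun q : ℝ × ℝ => w p q.1 q.2
  hasDerivAt : ∀ p ξ η, HasDerivAt (fun s => w p s η) (w (p + 1) ξ η) ξ

/-- The derivatives of `β w`. -/
noncomputable def jetMul (β w : ℕ → ℝ → ℝ → ℝ) (p : ℕ) (ξ η : ℝ) : ℝ :=
  ∑ ij ∈ Finset.HasAntidiagonal.antidiagonal p, (p.choose ij.1 : ℝ) * (β ij.1 ξ η * w ij.2 ξ η)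

/-- The derivatives of `∂_ξ w + β w`. -/
noncomputable def jetOp (β w : ℕ → ℝ → ℝ → ℝ) (p : ℕ) (ξ η : ℝ) : ℝ := w (p + 1) ξ η + jetMul β w p ξ η

/-- The derivatives of the primitive of `w` in the second variable that vanishes at `γ`. -/
noncomputable def jetInt (γ : ℝ) (w : ℕ → ℝ → ℝ → ℝ) (p : ℕ) (ξ η : ℝ) : ℝ := ∫ τ in γ..η, w p ξ τ

theorem IsJet.mul {β w : ℕ → ℝ → ℝ → ℝ} (hβ : IsJet β) (hw : IsJet w) : IsJet (jetMul β w) where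
  continuous p := by
    have h₁ := hβ.continuous
    have h₂ := hw.continuous
    unfold jetMul
    fun_prop
  hasDerivAt p ξ η := by
    have : HasDerivAt (fun s => jetMul β w p s η)
        (∑ ij ∈ Finset.HasAntidiagonal.antidiagonal p, (p.choose ij.1 : ℝ) *
          (β (ij.1 + 1) ξ η * w ij.2 ξ η + β ij.1 ξ η * w (ij.2 + 1) ξ η)) ξ :=
      HasDerivAt.fun_sum fun ij _ =>
        ((hβ.hasDerivAt ij.1 ξ η).mul (hw.hasDerivAt ij.2 ξ η)).const_mul _
    refine this.congr_deriv ?_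
    -- Pascal's rule splits the sum of order `p + 1` into the two halves of the product rule.
    rw [jetMul, Finset.sum_antidiagonal_choose_succ_mul fun i j => β i ξ η * w j ξ η,
      ← Finset.sum_add_distrib]
    refine Finset.sum_congr rfl fun ij hij => ?_
    rw [← Nat.choose_symm_of_eq_add (Finset.HasAntidiagonal.mem_antidiagonal.1 hij).symm]
    ring

theorem IsJet.op {β w : ℕ → ℝ → ℝ → ℝ} (hβ : IsJet β) (hw : IsJet w) : IsJet (jetOp β w) where
  continuous p := (hw.continuous (p + 1)).add ((hβ.mul hw).continuous p)
  hasDerivAt p ξ η := (hw.hasDerivAt (p + 1) ξ η).add ((hβ.mul hw).hasDerivAt p ξ η)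

theorem IsJet.slice {w : ℕ → ℝ → ℝ → ℝ} (hw : IsJet w) (p : ℕ) (ξ : ℝ) : Continuous (w p ξ) :=
  (hw.continuous p).comp (by fun_prop : Continuous fun η : ℝ => (ξ, η))

theorem IsJet.int {w : ℕ → ℝ → ℝ → ℝ} (hw : IsJet w) (γ : ℝ) : IsJet (jetInt γ w) where
  continuous p :=
    intervalIntegral.continuous_parametric_intervalIntegral_of_continuous
      (f := fun q : ℝ × ℝ => w p q.1)
      ((hw.continuous p).comp (by fun_prop : Continuous fun q : (ℝ × ℝ) × ℝ => (q.1.1, q.2)))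
      continuous_snd
  hasDerivAt p ξ η := hasDerivAt_intervalIntegral_param (hw.continuous p) (hw.continuous (p + 1))
    (hw.hasDerivAt p) γ η ξ

theorem IsJet.hasDerivAt_int {w : ℕ → ℝ → ℝ → ℝ} (hw : IsJet w) (γ : ℝ) (p : ℕ) (ξ η : ℝ) :
    HasDerivAt (fun s => jetInt γ w p ξ s) (w p ξ η) η :=
  ((hw.slice p ξ).integral_hasStrictDerivAt γ η).hasDerivAt

theorem IsJet.add {v w : ℕ → ℝ → ℝ → ℝ} (hv : IsJet v) (hw : IsJet w) :
    IsJet fun p ξ η => v p ξ η + w p ξ η where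
  continuous p := (hv.continuous p).add (hw.continuous p)
  hasDerivAt p ξ η := (hv.hasDerivAt p ξ η).add (hw.hasDerivAt p ξ η)

theorem IsJet.succ {w : ℕ → ℝ → ℝ → ℝ} (hw : IsJet w) : IsJet fun p => w (p + 1) where
  continuous p := hw.continuous (p + 1)
  hasDerivAt p := hw.hasDerivAt (p + 1)

theorem isJet_iteratedDeriv {u : ℝ → ℝ → ℝ} (hu : ContDiff ℝ ∞ fun p : ℝ × ℝ => u p.1 p.2) :
    IsJet fun p ξ η => iteratedDeriv p (fun s => u s η) ξ := by
  have h : ∀ p, ContDiff ℝ ∞ fun q : ℝ × ℝ => iteratedDeriv p (fun s => u s q.2) q.1 := by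
    intro p
    induction p with
    | zero => simpa using hu
    | succ p ih =>
      simp only [iteratedDeriv_succ]
      exact contDiff_deriv_fst (u := fun ξ η => iteratedDeriv p (fun s => u s η) ξ) ih
  refine ⟨fun p => (h p).continuous, fun p ξ η => ?_⟩
  rw [iteratedDeriv_succ]
  exact hasDerivAt_fst_of_contDiff (u := fun ξ η => iteratedDeriv p (fun s => u s η) ξ) (h p) ξ η

/-- `W_0 = w` and `W_{l+1}(ξ,η) = ∫_γ^η (∂_ξ + β) W_l (ξ,τ) dτ`, with all derivatives in `ξ`. -/
noncomputable def jetIter (γ : ℝ) (β w : ℕ → ℝ → ℝ → ℝ) : ℕ → ℕ → ℝ → ℝ → ℝ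
  | 0 => w
  | l + 1 => jetInt γ (jetOp β (jetIter γ β w l))

theorem IsJet.iter {β w : ℕ → ℝ → ℝ → ℝ} (hβ : IsJet β) (hw : IsJet w) (γ : ℝ) (l : ℕ) :
    IsJet (jetIter γ β w l) := by
  induction l with
  | zero => exact hw
  | succ l ih => exact (hβ.op ih).int γ

theorem jetOp_eq_zero {β w : ℕ → ℝ → ℝ → ℝ} {ξ η : ℝ} (h : ∀ p, w p ξ η = 0) (p : ℕ) :
    jetOp β w p ξ η = 0 := by
  simp [jetOp, jetMul, h]

/-- Differentiation in `ξ`, multiplication by `β` and integration in `η` are all local in `ξ`; hence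
no iterate creates boundary terms at `ξ = ±ε`. -/
theorem jetIter_eq_zero {β w : ℕ → ℝ → ℝ → ℝ} {ξ : ℝ} (h : ∀ p η, w p ξ η = 0) (γ : ℝ) (l : ℕ) :
    ∀ p η, jetIter γ β w l p ξ η = 0 := by
  induction l with
  | zero => exact h
  | succ l ih =>
    intro p η
    simp [jetIter, jetInt, jetOp_eq_zero fun p => ih p _]

/-! ### Gevrey bounds -/

section Bounds

variable {σ B M K : ℝ} {k : ℕ}

/-- Since `σ ≥ 1`, the binomial coefficient is at most its `σ`-th power, and enlarging it to
`(i+j+k).choose i` turns the product into one factorial. The Leibniz sum thus loses nothing in the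
Gevrey weight. -/
theorem choose_mul_factorial_rpow_le (hσ : 1 ≤ σ) (i j k : ℕ) :
    ((i + j).choose i : ℝ) * ((i ! : ℝ) ^ σ * ((j + k)! : ℝ) ^ σ) ≤ ((i + j + k)! : ℝ) ^ σ := by
  have hc : (1 : ℝ) ≤ ((i + j).choose i : ℝ) := by
    exact_mod_cast Nat.choose_pos (Nat.le_add_right i j)
  have h₁ : ((i + j).choose i : ℝ) ≤ ((i + j).choose i : ℝ) ^ σ := by
    simpa using Real.rpow_le_rpow_of_exponent_le hc hσ
  have h₂ : (i + j).choose i * (i ! * (j + k)!) ≤ (i + j + k)! := by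
    have e₁ : (i + j).choose i ≤ (i + (j + k)).choose i :=
      Nat.choose_le_choose i (by omega)
    calc (i + j).choose i * (i ! * (j + k)!) ≤ (i + (j + k)).choose i * (i ! * (j + k)!) := by
          gcongr
      _ = (i + j + k)! := by
        have := Nat.choose_mul_factorial_mul_factorial (Nat.le_add_right i (j + k))
        rw [Nat.add_sub_cancel_left, mul_assoc] at this
        rw [this, add_assoc]
  calc ((i + j).choose i : ℝ) * ((i ! : ℝ) ^ σ * ((j + k)! : ℝ) ^ σ)
      ≤ ((i + j).choose i : ℝ) ^ σ * ((i ! : ℝ) ^ σ * ((j + k)! : ℝ) ^ σ) := by gcongr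
    _ = (((i + j).choose i * (i ! * (j + k)!) : ℕ) : ℝ) ^ σ := by
      push_cast
      rw [Real.mul_rpow (by positivity) (by positivity), Real.mul_rpow (by positivity)
        (by positivity)]
    _ ≤ ((i + j + k)! : ℝ) ^ σ := by
      have : (((i + j).choose i * (i ! * (j + k)!) : ℕ) : ℝ) ≤ ((i + j + k)! : ℝ) := by
        exact_mod_cast h₂
      gcongr

theorem sum_antidiagonal_half_pow_le (p : ℕ) :
    ∑ ij ∈ Finset.HasAntidiagonal.antidiagonal p, (1 / 2 : ℝ) ^ (ij.1 + 1) ≤ 1 := by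
  rw [Finset.Nat.sum_antidiagonal_eq_sum_range_succ_mk]
  have : ∀ n : ℕ, ∑ i ∈ Finset.range n, (1 / 2 : ℝ) ^ (i + 1) = 1 - (1 / 2) ^ n := by
    intro n
    induction n with
    | zero => simp
    | succ n ih => rw [Finset.sum_range_succ, ih]; ring
  simp only [this]
  have : (0 : ℝ) ≤ (1 / 2) ^ p.succ := by positivity
  linarith

/-- One application of `∂_ξ + β` costs a factor `2 M (p + k + 1)^σ`. -/
theorem abs_jetOp_le (hσ : 1 ≤ σ) (hB : 0 ≤ B) (hBM : 2 * B ≤ M) (hK : 0 ≤ K)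
    {β w : ℕ → ℝ → ℝ → ℝ} {ξ η : ℝ} (hβ : ∀ i, |β i ξ η| ≤ B ^ (i + 1) * (i ! : ℝ) ^ σ)
    (hw : ∀ p, |w p ξ η| ≤ K * (M ^ (p + k) * ((p + k)! : ℝ) ^ σ)) (p : ℕ) :
    |jetOp β w p ξ η| ≤ 2 * K * (M ^ (p + (k + 1)) * ((p + (k + 1))! : ℝ) ^ σ) := by
  have hM : 0 ≤ M := by linarith
  have h₁ : |w (p + 1) ξ η| ≤ K * (M ^ (p + (k + 1)) * ((p + (k + 1))! : ℝ) ^ σ) := by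
    simpa [add_assoc, add_comm, add_left_comm] using hw (p + 1)
  have hfac : ((p + k)! : ℝ) ^ σ ≤ ((p + (k + 1))! : ℝ) ^ σ := by
    have : ((p + k)! : ℝ) ≤ ((p + (k + 1))! : ℝ) := by
      exact_mod_cast Nat.factorial_le (by omega)
    gcongr
  have h₂ : |jetMul β w p ξ η| ≤ K * (M ^ (p + (k + 1)) * ((p + (k + 1))! : ℝ) ^ σ) := by
    have term : ∀ ij ∈ Finset.HasAntidiagonal.antidiagonal p,
        |(p.choose ij.1 : ℝ) * (β ij.1 ξ η * w ij.2 ξ η)|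
          ≤ K * (M ^ (p + (k + 1)) * ((p + (k + 1))! : ℝ) ^ σ) * (1 / 2) ^ (ij.1 + 1) := by
      rintro ⟨i, j⟩ hij
      obtain rfl := Finset.HasAntidiagonal.mem_antidiagonal.1 hij
      simp only
      rw [abs_mul, abs_mul, Nat.abs_cast]
      -- The gap `2B ≤ M` supplies the geometric factor that makes the Leibniz sum bounded uniformly
      -- in `p`.
      have hB' : B ^ (i + 1) ≤ M ^ (i + 1) * (1 / 2) ^ (i + 1) := by
        rw [← mul_pow]
        exact pow_le_pow_left₀ hB (by linarith) _
      calc ((i + j).choose i : ℝ) * (|β i ξ η| * |w j ξ η|)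
          ≤ ((i + j).choose i : ℝ) * ((B ^ (i + 1) * (i ! : ℝ) ^ σ)
            * (K * (M ^ (j + k) * ((j + k)! : ℝ) ^ σ))) := by
            gcongr
            · exact hβ i
            · exact hw j
        _ = K * (B ^ (i + 1) * M ^ (j + k)) *
            (((i + j).choose i : ℝ) * ((i ! : ℝ) ^ σ * ((j + k)! : ℝ) ^ σ)) := by ring
        _ ≤ K * ((M ^ (i + 1) * (1 / 2) ^ (i + 1)) * M ^ (j + k)) * ((i + j + k)! : ℝ) ^ σ := by
            gcongr
            exact choose_mul_factorial_rpow_le hσ i j k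
        _ ≤ K * ((M ^ (i + 1) * (1 / 2) ^ (i + 1)) * M ^ (j + k))
              * ((i + j + (k + 1))! : ℝ) ^ σ := by gcongr
        _ = _ := by ring
    calc |jetMul β w p ξ η| ≤ ∑ ij ∈ Finset.HasAntidiagonal.antidiagonal p,
          |(p.choose ij.1 : ℝ) * (β ij.1 ξ η * w ij.2 ξ η)| := Finset.abs_sum_le_sum_abs _ _
      _ ≤ ∑ ij ∈ Finset.HasAntidiagonal.antidiagonal p,
          K * (M ^ (p + (k + 1)) * ((p + (k + 1))! : ℝ) ^ σ) * (1 / 2) ^ (ij.1 + 1) :=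
          Finset.sum_le_sum term
      _ ≤ K * (M ^ (p + (k + 1)) * ((p + (k + 1))! : ℝ) ^ σ) * 1 := by
          rw [← Finset.mul_sum]
          gcongr
          exact sum_antidiagonal_half_pow_le p
      _ = _ := mul_one _
  calc |jetOp β w p ξ η| ≤ |w (p + 1) ξ η| + |jetMul β w p ξ η| := abs_add_le _ _
    _ ≤ _ := by linarith

/-- Divided powers of `γ - τ` reproduce under integration; this is the source of the gain `1/k!`. -/
theorem abs_integral_le_of_abs_le_pow {u : ℝ → ℝ} (hu : Continuous u) {A γ η : ℝ} (hη : η ≤ γ)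
    (h : ∀ τ ∈ Icc η γ, |u τ| ≤ A * ((γ - τ) ^ k / k !)) :
    |∫ τ in γ..η, u τ| ≤ A * ((γ - η) ^ (k + 1) / (k + 1)!) := by
  rw [intervalIntegral.integral_symm, abs_neg]
  have e : (∫ τ in η..γ, A * ((γ - τ) ^ k / k !)) = A * ((γ - η) ^ (k + 1) / (k + 1)!) := by
    rw [intervalIntegral.integral_const_mul, intervalIntegral.integral_div,
      intervalIntegral.integral_comp_sub_left (fun t => t ^ k) γ, integral_pow]
    rw [Nat.factorial_succ]
    push_cast
    field_simp
    simp
  rw [← e]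
  refine (intervalIntegral.abs_integral_le_integral_abs hη).trans
    (intervalIntegral.integral_mono_on hη (hu.abs.intervalIntegrable _ _)
      (Continuous.intervalIntegrable (by fun_prop) _ _) h)

/-- Each step shifts the Gevrey index by one through `∂_ξ + β` and raises the divided power by one
through the integration. The constant in `abs_jetOp_le` may depend on the point, so the divided
power is carried inside it. -/
theorem abs_jetIter_le (hσ : 1 ≤ σ) (hB : 0 ≤ B) (hBM : 2 * B ≤ M) (hK : 0 ≤ K)
    {β w : ℕ → ℝ → ℝ → ℝ} (jβ : IsJet β) (jw : IsJet w) {γ ξ : ℝ}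
    (hβ : ∀ i, ∀ η ∈ Icc (-γ) γ, |β i ξ η| ≤ B ^ (i + 1) * (i ! : ℝ) ^ σ)
    (hw : ∀ p, ∀ η ∈ Icc (-γ) γ, |w p ξ η| ≤ K * (M ^ p * (p ! : ℝ) ^ σ)) (l : ℕ) :
    ∀ p, ∀ η ∈ Icc (-γ) γ, |jetIter γ β w l p ξ η|
      ≤ 2 ^ l * K * ((γ - η) ^ l / l !) * (M ^ (p + l) * ((p + l)! : ℝ) ^ σ) := by
  have hM : 0 ≤ M := by linarith
  induction l with
  | zero => simpa [jetIter] using hw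
  | succ l ih =>
    intro p η hη
    have key := abs_integral_le_of_abs_le_pow (k := l) ((jβ.op (jβ.iter jw γ l)).slice p ξ)
      (A := 2 ^ (l + 1) * K * (M ^ (p + (l + 1)) * ((p + (l + 1))! : ℝ) ^ σ)) hη.2
      (fun τ hτ => ?_)
    · refine key.trans (le_of_eq (by ring))
    · have hτ' : τ ∈ Icc (-γ) γ := ⟨hη.1.trans hτ.1, hτ.2⟩
      have : 0 ≤ γ - τ := sub_nonneg.2 hτ.2
      refine (abs_jetOp_le (k := l) hσ hB hBM (K := 2 ^ l * K * ((γ - τ) ^ l / l !))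
        (by positivity) (fun i => hβ i τ hτ') (fun q => ih q τ hτ') p).trans (le_of_eq (by ring))

end Bounds

/-! ### The transport equation for the moments -/

/-- The `ξ`-derivatives of `a`. -/
noncomputable def jetOf (a : ℝ → ℝ → ℝ) (p : ℕ) (ξ η : ℝ) : ℝ :=
  iteratedDeriv p (fun s => a s η) ξ

theorem jetOf_zero (a : ℝ → ℝ → ℝ) (ξ η : ℝ) : jetOf a 0 ξ η = a ξ η := by simp [jetOf]

theorem isJet_jetOf {a : ℝ → ℝ → ℝ} (ha : ContDiff ℝ ∞ fun p : ℝ × ℝ => a p.1 p.2) :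
    IsJet (jetOf a) := isJet_iteratedDeriv ha

/-- The `ξ`-derivatives of `b + ∂_ξ A`, where `A(ξ,η) = ∫_γ^η a(ξ,τ) dτ`. -/
noncomputable def jetConn (a b : ℝ → ℝ → ℝ) (γ : ℝ) (p : ℕ) (ξ η : ℝ) : ℝ :=
  jetOf b p ξ η + jetInt γ (fun p => jetOf a (p + 1)) p ξ η

theorem isJet_jetConn {a b : ℝ → ℝ → ℝ} (ha : ContDiff ℝ ∞ fun p : ℝ × ℝ => a p.1 p.2)
    (hb : ContDiff ℝ ∞ fun p : ℝ × ℝ => b p.1 p.2) (γ : ℝ) : IsJet (jetConn a b γ) :=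
  (isJet_jetOf hb).add ((isJet_jetOf ha).succ.int γ)

section Transport

variable {a b : ℝ → ℝ → ℝ} (ha : ContDiff ℝ ∞ fun p : ℝ × ℝ => a p.1 p.2)
  (hb : ContDiff ℝ ∞ fun p : ℝ × ℝ => b p.1 p.2)
  {f : ℝ → ℝ → ℂ} (hf : Continuous fun p : ℝ × ℝ => f p.1 p.2)
  (hf₀ : ∀ x y, y ≤ x ^ 2 → f x y = 0)
  {m : ℝ → ℝ → ℝ → ℝ} (hm : ContDiff ℝ ∞ fun p : ℝ × ℝ × ℝ => m p.1 p.2.1 p.2.2)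
  (hsol : SolvesWeightEquation a b m) {ε γ : ℝ} (hε : 0 ≤ ε) (hγ : ε ^ 2 / 4 ≤ γ)

include ha hb hf hf₀ hm hsol hε hγ

/-- The test function is `X = e^A w`. As `∂_η A = a`, the factor `a X - ∂_η X` reduces to `-e^A v`,
while `∂_ξ A` joins `b` in the connection coefficient. On `η = γ` the exponential is `1`. -/
theorem transport_step {w : ℕ → ℝ → ℝ → ℝ} (hw : IsJet w) {v : ℝ → ℝ → ℝ}
    (hv : ∀ ξ η, HasDerivAt (fun s => w 0 ξ s) (v ξ η) η)
    (cv : Continuous fun p : ℝ × ℝ => v p.1 p.2)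
    (hleft : ∀ η, w 0 (-ε) η = 0) (hright : ∀ η, w 0 ε η = 0) (j : ℕ) :
    (∫ ξ in (-ε)..ε, ∫ η in (-γ)..γ,
        (((Real.exp (jetInt γ (jetOf a) 0 ξ η) * jetOp (jetConn a b γ) w 0 ξ η : ℝ) : ℂ)
          * weightedRadon (powWeight j m) f ξ η
        - ((Real.exp (jetInt γ (jetOf a) 0 ξ η) * v ξ η : ℝ) : ℂ)
          * weightedRadon (powWeight (j + 1) m) f ξ η))
      = -∫ ξ in (-ε)..ε, (w 0 ξ γ : ℂ) * weightedRadon (powWeight (j + 1) m) f ξ γ := by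
  have jA : IsJet (jetInt γ (jetOf a)) := (isJet_jetOf ha).int γ
  have cA := jA.continuous 0
  have cA₁ := jA.continuous 1
  have cw := hw.continuous 0
  have cw₁ := hw.continuous 1
  have ca := ha.continuous
  have dA : ∀ ξ η, HasDerivAt (fun s => jetInt γ (jetOf a) 0 ξ s) (a ξ η) η := fun ξ η => by
    have := (isJet_jetOf ha).hasDerivAt_int γ 0 ξ η
    rwa [jetOf_zero] at this
  have key := weak_transport_weightedRadon hf hf₀ ca hb.continuous hm hsol
    (X := fun ξ η => Real.exp (jetInt γ (jetOf a) 0 ξ η) * w 0 ξ η)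
    (X₁ := fun ξ η => Real.exp (jetInt γ (jetOf a) 0 ξ η) * jetInt γ (jetOf a) 1 ξ η * w 0 ξ η
      + Real.exp (jetInt γ (jetOf a) 0 ξ η) * w 1 ξ η)
    (X₂ := fun ξ η => Real.exp (jetInt γ (jetOf a) 0 ξ η) * a ξ η * w 0 ξ η
      + Real.exp (jetInt γ (jetOf a) 0 ξ η) * v ξ η)
    (fun ξ η => (jA.hasDerivAt 0 ξ η).exp.mul (hw.hasDerivAt 0 ξ η))
    (fun ξ η => (dA ξ η).exp.mul (hv ξ η))
    (by fun_prop) (by fun_prop) (by fun_prop) hε hγ (by simp [hleft]) (by simp [hright]) j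
  have e : ∀ ξ, Real.exp (jetInt γ (jetOf a) 0 ξ γ) = 1 := by simp [jetInt]
  simp only [e, one_mul] at key
  rw [← key]
  refine intervalIntegral.integral_congr fun ξ _ => intervalIntegral.integral_congr fun η _ => ?_
  have e₁ : jetOp (jetConn a b γ) w 0 ξ η
      = w 1 ξ η + (b ξ η + jetInt γ (jetOf a) 1 ξ η) * w 0 ξ η := by
    simp [jetOp, jetMul, jetConn, jetOf, jetInt]
  simp only [e₁]
  push_cast
  ring

/-- Each iteration trades one power of `x` in the weight: `W_{l+1}` vanishes on `η = γ` and `∂_η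
W_{l+1} = (∂_ξ + β) W_l`, so the pairing of `W_{l+1}` with `R_j` equals that of `W_l` with
`R_{j+1}`. For `l = 0` the function `w` is constant in `η` and only the boundary term remains. -/
theorem integral_jetOp_iter_eq {w : ℕ → ℝ → ℝ → ℝ} (hw : IsJet w)
    (hconst : ∀ ξ η, w 0 ξ η = w 0 ξ γ)
    (hleft : ∀ p η, w p (-ε) η = 0) (hright : ∀ p η, w p ε η = 0) (l : ℕ) : ∀ j : ℕ,
    (∫ ξ in (-ε)..ε, ∫ η in (-γ)..γ,
        ((Real.exp (jetInt γ (jetOf a) 0 ξ η)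
            * jetOp (jetConn a b γ) (jetIter γ (jetConn a b γ) w l) 0 ξ η : ℝ) : ℂ)
          * weightedRadon (powWeight j m) f ξ η)
      = -∫ ξ in (-ε)..ε, (w 0 ξ γ : ℂ) * weightedRadon (powWeight (j + l + 1) m) f ξ γ := by
  have jβ := isJet_jetConn ha hb γ
  induction l with
  | zero =>
    intro j
    have := transport_step ha hb hf hf₀ hm hsol hε hγ hw (v := fun _ _ => 0)
      (fun ξ η => by
        rw [show (fun s => w 0 ξ s) = fun _ => w 0 ξ γ from funext fun s => hconst ξ s]
        exact hasDerivAt_const _ _) continuous_const (hleft 0) (hright 0) j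
    simpa [jetIter] using this
  | succ l ih =>
    intro j
    have jW := jβ.iter hw γ l
    have jO := jβ.op jW
    have step := transport_step ha hb hf hf₀ hm hsol hε hγ (jβ.iter hw γ (l + 1))
      (v := jetOp (jetConn a b γ) (jetIter γ (jetConn a b γ) w l) 0)
      (fun ξ η => jO.hasDerivAt_int γ 0 ξ η) (jO.continuous 0)
      (jetIter_eq_zero hleft γ (l + 1) 0) (jetIter_eq_zero hright γ (l + 1) 0) j
    have hend : ∀ ξ, jetIter γ (jetConn a b γ) w (l + 1) 0 ξ γ = 0 := by simp [jetIter, jetInt]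
    simp only [hend, Complex.ofReal_zero, zero_mul, intervalIntegral.integral_zero, neg_zero]
      at step
    have cA := ((isJet_jetOf ha).int γ).continuous 0
    have cI : ∀ (l j : ℕ), Continuous fun p : ℝ × ℝ =>
        ((Real.exp (jetInt γ (jetOf a) 0 p.1 p.2)
            * jetOp (jetConn a b γ) (jetIter γ (jetConn a b γ) w l) 0 p.1 p.2 : ℝ) : ℂ)
          * weightedRadon (powWeight j m) f p.1 p.2 := fun l j =>
      (Complex.continuous_ofReal.comp ((Real.continuous_exp.comp cA).mul
        ((jβ.op (jβ.iter hw γ l)).continuous 0))).mul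
        (continuous_weightedRadon hf hf₀ (continuous_powWeight j hm.continuous))
    have cJ : ∀ (l j : ℕ), Continuous fun ξ => ∫ η in (-γ)..γ,
        ((Real.exp (jetInt γ (jetOf a) 0 ξ η)
            * jetOp (jetConn a b γ) (jetIter γ (jetConn a b γ) w l) 0 ξ η : ℝ) : ℂ)
          * weightedRadon (powWeight j m) f ξ η := fun l j =>
      intervalIntegral.continuous_parametric_intervalIntegral_of_continuous' (cI l j) _ _
    have cs : ∀ (l j : ℕ) (ξ : ℝ), IntervalIntegrable (fun η =>
        ((Real.exp (jetInt γ (jetOf a) 0 ξ η)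
            * jetOp (jetConn a b γ) (jetIter γ (jetConn a b γ) w l) 0 ξ η : ℝ) : ℂ)
          * weightedRadon (powWeight j m) f ξ η) volume (-γ) γ := fun l j ξ =>
      ((cI l j).comp (by fun_prop : Continuous fun η : ℝ => (ξ, η))).intervalIntegrable _ _
    simp_rw [intervalIntegral.integral_sub (cs (l + 1) j _) (cs l (j + 1) _)] at step
    rw [intervalIntegral.integral_sub ((cJ _ _).intervalIntegrable _ _)
      ((cJ _ _).intervalIntegrable _ _), sub_eq_zero, ih (j + 1)] at step
    rw [step, show j + 1 + l + 1 = j + (l + 1) + 1 by ring]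

end Transport

/-! ### Estimates -/

theorem norm_integral_le_mul_lineNorm {g : ℝ → ℝ → ℂ} (hg : Continuous fun p : ℝ × ℝ => g p.1 p.2)
    {Y : ℝ → ℝ} {D ε γ : ℝ} (hε : 0 ≤ ε) (hD : ∀ ξ ∈ Icc (-ε) ε, |Y ξ| ≤ D) :
    ‖∫ ξ in (-ε)..ε, (Y ξ : ℂ) * g ξ γ‖ ≤ D * lineNorm ε γ g := by
  have e : lineNorm ε γ g = ∫ ξ in (-ε)..ε, ‖g ξ γ‖ := by
    rw [lineNorm, integral_Icc_eq_integral_Ioc, intervalIntegral.integral_of_le (by linarith)]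
  rw [e, ← intervalIntegral.integral_const_mul]
  refine intervalIntegral.norm_integral_le_of_norm_le (by linarith)
    (Filter.Eventually.of_forall fun ξ hξ => ?_) (Continuous.intervalIntegrable
      (continuous_const.mul (hg.comp (by fun_prop : Continuous fun ξ : ℝ => (ξ, γ))).norm) _ _)
  rw [norm_mul, Complex.norm_real, Real.norm_eq_abs]
  exact mul_le_mul_of_nonneg_right (hD ξ (Ioc_subset_Icc_self hξ)) (norm_nonneg _)

theorem norm_integral_le_mul_rectNorm {g : ℝ → ℝ → ℂ} (hg : Continuous fun p : ℝ × ℝ => g p.1 p.2)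
    {Y : ℝ → ℝ → ℝ} {D ε γ : ℝ} (hε : 0 ≤ ε) (hγ : 0 ≤ γ)
    (hD : ∀ ξ ∈ Icc (-ε) ε, ∀ η ∈ Icc (-γ) γ, |Y ξ η| ≤ D) :
    ‖∫ ξ in (-ε)..ε, ∫ η in (-γ)..γ, (Y ξ η : ℂ) * g ξ η‖ ≤ D * rectNorm ε γ g := by
  have e : rectNorm ε γ g = ∫ ξ in (-ε)..ε, ∫ η in (-γ)..γ, ‖g ξ η‖ := by
    have hint : IntegrableOn (fun p : ℝ × ℝ => ‖g p.1 p.2‖) (Icc (-ε) ε ×ˢ Ioo (-γ) γ)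
        (volume.prod volume) :=
      ((hg.norm.continuousOn).integrableOn_compact (isCompact_Icc.prod isCompact_Icc)).mono_set
        (prod_mono_right Ioo_subset_Icc_self)
    rw [rectNorm, Measure.volume_eq_prod, setIntegral_prod _ hint, integral_Icc_eq_integral_Ioc,
      intervalIntegral.integral_of_le (by linarith)]
    refine integral_congr_ae (Filter.Eventually.of_forall fun ξ => ?_)
    simp only
    rw [intervalIntegral.integral_of_le (by linarith), integral_Ioc_eq_integral_Ioo]
  have ci : Continuous fun ξ => ∫ η in (-γ)..γ, ‖g ξ η‖ :=
    intervalIntegral.continuous_parametric_intervalIntegral_of_continuous' hg.norm _ _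
  rw [e, ← intervalIntegral.integral_const_mul]
  refine intervalIntegral.norm_integral_le_of_norm_le (by linarith)
    (Filter.Eventually.of_forall fun ξ hξ => ?_)
    ((continuous_const.mul ci).intervalIntegrable _ _)
  rw [← intervalIntegral.integral_const_mul]
  refine intervalIntegral.norm_integral_le_of_norm_le (by linarith)
    (Filter.Eventually.of_forall fun η hη => ?_) (Continuous.intervalIntegrable
      (continuous_const.mul (hg.comp (by fun_prop : Continuous fun η : ℝ => (ξ, η))).norm) _ _)
  rw [norm_mul, Complex.norm_real, Real.norm_eq_abs]
  exact mul_le_mul_of_nonneg_right (hD ξ (Ioc_subset_Icc_self hξ) η (Ioc_subset_Icc_self hη))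
    (norm_nonneg _)

theorem iteratedDeriv_dilate {ϕ : ℝ → ℝ} (hϕ : ContDiff ℝ ∞ ϕ) (ε : ℝ) (p : ℕ) (ξ : ℝ) :
    iteratedDeriv p (dilate ϕ ε) ξ = ε⁻¹ * (ε⁻¹ ^ p * iteratedDeriv p ϕ (ε⁻¹ * ξ)) := by
  have e : dilate ϕ ε = fun t => ε⁻¹ * ϕ (ε⁻¹ * t) := by
    funext t
    rw [dilate, div_eq_inv_mul]
  rw [e, iteratedDeriv_const_mul_field,
    iteratedDeriv_comp_const_mul (hϕ.of_le (by exact_mod_cast le_top))]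

/-- The endpoints are included because the set where a continuous function is nonzero is open, hence
lies in the interior of `[-1, 1]`. -/
theorem iteratedDeriv_eq_zero_of_tsupport {ϕ : ℝ → ℝ} (hϕ : ContDiff ℝ ∞ ϕ)
    (hs : tsupport ϕ ⊆ Icc (-1) 1) (p : ℕ) {t : ℝ} (ht : 1 ≤ |t|) : iteratedDeriv p ϕ t = 0 := by
  have hsub : ∀ p, tsupport (iteratedDeriv p ϕ) ⊆ tsupport ϕ := by
    intro p
    induction p with
    | zero => simp
    | succ p ih =>
      rw [iteratedDeriv_succ]
      exact tsupport_deriv_subset.trans ih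
  have c : Continuous (iteratedDeriv p ϕ) := hϕ.continuous_iteratedDeriv p (by exact_mod_cast le_top)
  by_contra h
  have hI : Function.support (iteratedDeriv p ϕ) ⊆ interior (Icc (-1) 1) :=
    interior_maximal ((subset_tsupport _).trans ((hsub p).trans hs)) c.isOpen_support
  rw [interior_Icc] at hI
  have : t ∈ Ioo (-1 : ℝ) 1 := hI h
  exact absurd (abs_lt.2 this) (not_lt.2 ht)

theorem natCast_succ_le_two_pow (i : ℕ) : ((i : ℝ) + 1) ≤ 2 ^ i := by
  exact_mod_cast Nat.lt_two_pow_self (n := i)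

/-- A Gevrey bound for the connection coefficient `b + ∂_ξ A`. -/
theorem abs_jetConn_le {σ : ℝ} (hσ : 1 ≤ σ) {a b : ℝ → ℝ → ℝ}
    {Ca Cb γ Γ ξ : ℝ} (hCa : 0 < Ca) (hCb : 0 < Cb)
    (hγ : 0 ≤ γ) (hγΓ : γ ≤ Γ)
    (hA : ∀ i, ∀ η ∈ Icc (-γ) γ, |jetOf a i ξ η| ≤ Ca ^ (i + 1) * (i ! : ℝ) ^ σ)
    (hB : ∀ i, ∀ η ∈ Icc (-γ) γ, |jetOf b i ξ η| ≤ Cb ^ (i + 1) * (i ! : ℝ) ^ σ)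
    (i : ℕ) {η : ℝ} (hη : η ∈ Icc (-γ) γ) :
    |jetConn a b γ i ξ η|
      ≤ (2 * (Cb + (1 + 2 * Γ * Ca) * Ca * 2 ^ σ)) ^ (i + 1) * (i ! : ℝ) ^ σ := by
  have hΓ : 0 ≤ Γ := hγ.trans hγΓ
  set D := Cb + (1 + 2 * Γ * Ca) * Ca * 2 ^ σ with hD
  have hF : (0 : ℝ) ≤ (i ! : ℝ) ^ σ := by positivity
  have hP : (0 : ℝ) < 2 ^ σ := by positivity
  have h₁ : |jetOf b i ξ η| ≤ D ^ (i + 1) * (i ! : ℝ) ^ σ := by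
    refine (hB i η hη).trans ?_
    have : Cb ≤ D := by
      have : 0 ≤ (1 + 2 * Γ * Ca) * Ca * 2 ^ σ := by positivity
      linarith
    gcongr
  have h₂ : |jetInt γ (fun p => jetOf a (p + 1)) i ξ η|
      ≤ Ca ^ (i + 1 + 1) * ((i + 1)! : ℝ) ^ σ * |η - γ| := by
    rw [jetInt, ← Real.norm_eq_abs]
    refine intervalIntegral.norm_integral_le_of_norm_le_const fun τ hτ => hA (i + 1) τ ?_
    rw [uIoc_of_ge hη.2] at hτ
    exact ⟨hη.1.trans hτ.1.le, hτ.2⟩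
  have h₃ : |η - γ| ≤ 2 * Γ := by
    rw [abs_le]
    constructor <;> linarith [hη.1, hη.2]
  -- The extra derivative in `∂_ξ A` costs `(i+1)^σ`, absorbed by a geometric factor.
  have h₄ : ((i + 1)! : ℝ) ^ σ ≤ (2 ^ σ) ^ (i + 1) * (i ! : ℝ) ^ σ := by
    rw [Nat.factorial_succ]
    push_cast
    rw [Real.mul_rpow (by positivity) (by positivity)]
    gcongr
    rw [Real.rpow_pow_comm (by norm_num)]
    have : (i : ℝ) + 1 ≤ 2 ^ (i + 1) :=
      (natCast_succ_le_two_pow i).trans (pow_le_pow_right₀ (by norm_num) (by omega))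
    exact Real.rpow_le_rpow (by positivity) this (by linarith)
  have h₅ : Ca ^ (i + 1 + 1) * ((i + 1)! : ℝ) ^ σ * |η - γ| ≤ D ^ (i + 1) * (i ! : ℝ) ^ σ := by
    have hq : 2 * Γ * Ca ≤ (1 + 2 * Γ * Ca) ^ (i + 1) := by
      have h0 : 0 ≤ 2 * Γ * Ca := by positivity
      calc 2 * Γ * Ca ≤ 1 + 2 * Γ * Ca := by linarith
        _ ≤ (1 + 2 * Γ * Ca) ^ (i + 1) := le_self_pow₀ (by linarith) (by omega)
    calc Ca ^ (i + 1 + 1) * ((i + 1)! : ℝ) ^ σ * |η - γ|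
        ≤ Ca ^ (i + 1 + 1) * ((2 ^ σ) ^ (i + 1) * (i ! : ℝ) ^ σ) * (2 * Γ) := by gcongr
      _ = (2 * Γ * Ca) * (Ca ^ (i + 1) * (2 ^ σ) ^ (i + 1)) * (i ! : ℝ) ^ σ := by ring
      _ ≤ (1 + 2 * Γ * Ca) ^ (i + 1) * (Ca ^ (i + 1) * (2 ^ σ) ^ (i + 1)) * (i ! : ℝ) ^ σ := by
        gcongr
      _ = ((1 + 2 * Γ * Ca) * Ca * 2 ^ σ) ^ (i + 1) * (i ! : ℝ) ^ σ := by
        rw [mul_pow, mul_pow]; ring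
      _ ≤ D ^ (i + 1) * (i ! : ℝ) ^ σ := by
        gcongr
        linarith
  have h₆ : 2 * D ^ (i + 1) ≤ (2 * D) ^ (i + 1) := by
    have hD0 : 0 ≤ D := by positivity
    rw [mul_pow]
    gcongr
    exact le_self_pow₀ (by norm_num) (by omega)
  calc |jetConn a b γ i ξ η| ≤ D ^ (i + 1) * (i ! : ℝ) ^ σ + D ^ (i + 1) * (i ! : ℝ) ^ σ :=
        (abs_add_le _ _).trans (add_le_add h₁ (h₂.trans h₅))
    _ = (2 * D ^ (i + 1)) * (i ! : ℝ) ^ σ := by ring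
    _ ≤ _ := by gcongr

/-- Here the exponent drops from `σ` to `σ - 1`: one full factorial cancels against the gain from
integration. -/
theorem factorial_rpow_div_le {σ : ℝ} (k : ℕ) :
    ((k + 1)! : ℝ) ^ σ / k ! ≤ 2 ^ (k + 1) * ((k + 1)! : ℝ) ^ (σ - 1) := by
  have hpos : (0 : ℝ) < ((k + 1)! : ℝ) := by positivity
  have e : ((k + 1)! : ℝ) ^ σ = ((k + 1)! : ℝ) ^ (σ - 1) * ((k + 1)! : ℝ) := by
    rw [Real.rpow_sub_one hpos.ne']
    field_simp
  have e₂ : ((k + 1)! : ℝ) / k ! = k + 1 := by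
    rw [Nat.factorial_succ]
    push_cast
    field_simp
  rw [e, mul_div_assoc, e₂, mul_comm]
  gcongr
  exact (natCast_succ_le_two_pow k).trans (pow_le_pow_right₀ (by norm_num) (by omega))

/-- The Gevrey bounds in the first variable on a rectangle. -/
theorem IsGevrey₂.exists_abs_jetOf_le {σ : ℝ} {a : ℝ → ℝ → ℝ} (ha : IsGevrey₂ σ a) (L H : ℝ) :
    ∃ C : ℝ, 0 < C ∧ ∀ i, ∀ ξ ∈ Icc (-L) L, ∀ η ∈ Icc (-H) H,
      |jetOf a i ξ η| ≤ C ^ (i + 1) * (i ! : ℝ) ^ σ := by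
  obtain ⟨C, hC, h⟩ := ha.2 _ ((isCompact_Icc (a := -L) (b := L)).prod
    (isCompact_Icc (a := -H) (b := H)))
  refine ⟨C, hC, fun i ξ hξ η hη => ?_⟩
  simpa [mixedPartial, jetOf] using h i 0 (ξ, η) ⟨hξ, hη⟩

/-- The kernel that represents the moments of positive order is of Gevrey size. -/
theorem abs_exp_mul_jetOp_le {σ B M M₁ K Ca Γ ε γ ξ η : ℝ} (hσ : 1 ≤ σ) (hB : 0 ≤ B)
    (hBM : 2 * B ≤ M) (hK : 0 ≤ K) (hM : M = M₁ / ε) (hγΓ : γ ≤ Γ) (hCa : 0 ≤ Ca)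
    {α β w : ℕ → ℝ → ℝ → ℝ} (jβ : IsJet β) (jw : IsJet w)
    (hα : ∀ η ∈ Icc (-γ) γ, |α 0 ξ η| ≤ Ca)
    (hβ : ∀ i, ∀ η ∈ Icc (-γ) γ, |β i ξ η| ≤ B ^ (i + 1) * (i ! : ℝ) ^ σ)
    (hw : ∀ p, ∀ η ∈ Icc (-γ) γ, |w p ξ η| ≤ K * (M ^ p * (p ! : ℝ) ^ σ))
    (hη : η ∈ Icc (-γ) γ) (k : ℕ) :
    |Real.exp (jetInt γ α 0 ξ η) * jetOp β (jetIter γ β w k) 0 ξ η|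
      ≤ Real.exp (2 * Γ * Ca) * K * (4 * M₁ * (1 + 2 * Γ) / ε) ^ (k + 1)
        * ((k + 1)! : ℝ) ^ (σ - 1) := by
  have hM₀ : 0 ≤ M := by linarith
  have hγ₀ : 0 ≤ γ - η := sub_nonneg.2 hη.2
  have hle : γ - η ≤ 2 * Γ := by linarith [hη.1]
  have hΓ : 0 ≤ 2 * Γ := hγ₀.trans hle
  have hA : jetInt γ α 0 ξ η ≤ 2 * Γ * Ca := by
    have h₁ : |jetInt γ α 0 ξ η| ≤ Ca * |η - γ| := by
      rw [jetInt, ← Real.norm_eq_abs]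
      refine intervalIntegral.norm_integral_le_of_norm_le_const fun τ hτ => hα τ ?_
      rw [uIoc_of_ge hη.2] at hτ
      exact ⟨hη.1.trans hτ.1.le, hτ.2⟩
    rw [abs_sub_comm, abs_of_nonneg hγ₀] at h₁
    calc jetInt γ α 0 ξ η ≤ Ca * (γ - η) := (le_abs_self _).trans h₁
      _ ≤ Ca * (2 * Γ) := by gcongr
      _ = 2 * Γ * Ca := mul_comm _ _
  have hO := abs_jetOp_le (k := k) hσ hB hBM (K := 2 ^ k * K * ((γ - η) ^ k / k !))
    (by positivity) (fun i => hβ i η hη)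
    (fun p => abs_jetIter_le hσ hB hBM hK jβ jw hβ hw k p η hη) 0
  have hpow : (γ - η) ^ k ≤ (1 + 2 * Γ) ^ (k + 1) :=
    calc (γ - η) ^ k ≤ (1 + 2 * Γ) ^ k := by gcongr; linarith
      _ ≤ (1 + 2 * Γ) ^ (k + 1) := pow_le_pow_right₀ (by linarith) (by omega)
  rw [abs_mul, Real.abs_exp]
  simp only [zero_add] at hO
  calc Real.exp (jetInt γ α 0 ξ η) * |jetOp β (jetIter γ β w k) 0 ξ η|
      ≤ Real.exp (2 * Γ * Ca) *
        (2 * (2 ^ k * K * ((γ - η) ^ k / k !)) * (M ^ (k + 1) * ((k + 1)! : ℝ) ^ σ)) := by gcongr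
    _ = Real.exp (2 * Γ * Ca) * K * (2 ^ (k + 1) * M ^ (k + 1)) * (γ - η) ^ k
        * (((k + 1)! : ℝ) ^ σ / k !) := by ring
    _ ≤ Real.exp (2 * Γ * Ca) * K * (2 ^ (k + 1) * M ^ (k + 1)) * (1 + 2 * Γ) ^ (k + 1)
        * (2 ^ (k + 1) * ((k + 1)! : ℝ) ^ (σ - 1)) := by
      gcongr
      exact factorial_rpow_div_le k
    _ = Real.exp (2 * Γ * Ca) * K * (2 * M * (1 + 2 * Γ) * 2) ^ (k + 1)
        * ((k + 1)! : ℝ) ^ (σ - 1) := by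
      rw [mul_pow, mul_pow, mul_pow]; ring
    _ = _ := by
      rw [hM]
      congr 3
      ring

end LocalRadon

/-! ### The moment estimate -/

open LocalRadon in
theorem mainTheorem9 (σ : ℝ) (hσ : 1 < σ)
    (a b : ℝ → ℝ → ℝ) (ha : LocalRadon.IsGevrey₂ σ a) (hb : LocalRadon.IsGevrey₂ σ b)
    (ϕ : ℝ → ℝ) (hϕ : LocalRadon.IsTestFunction σ ϕ)
    (Γ : ℝ) (hΓ : 0 < Γ) (c : ℝ) (hc : 0 < c) :
    ∃ C : ℝ, 0 < C ∧
      ∀ N : ℝ → ℝ → (ℝ → ℝ → ℂ) → ℝ, LocalRadon.DominatesData c Γ N →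
      ∀ m : ℝ → ℝ → ℝ → ℝ,
        ContDiff ℝ ∞ (fun p : ℝ × ℝ × ℝ => m p.1 p.2.1 p.2.2) →
        LocalRadon.SolvesWeightEquation a b m →
      ∀ f : ℝ → ℝ → ℂ,
        Continuous (fun p : ℝ × ℝ => f p.1 p.2) →
        tsupport (fun p : ℝ × ℝ => f p.1 p.2) ⊆ {p : ℝ × ℝ | p.1 ^ 2 ≤ p.2} →
      ∀ ε γ : ℝ, 0 < ε → ε ^ 2 / 4 ≤ γ → γ ≤ Γ →
      ∀ k : ℕ,
        Integrable (fun x : ℝ =>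
          (x : ℂ) ^ k * LocalRadon.mean ϕ ε γ (LocalRadon.mulWeight f m γ) x) ∧
        ‖LocalRadon.moment k (LocalRadon.mean ϕ ε γ (LocalRadon.mulWeight f m γ))‖
          ≤ (C / ε) ^ (k + 1) * (k ! : ℝ) ^ (σ - 1)
            * N ε γ (LocalRadon.weightedRadon m f) := by
  -- The box must not depend on `ε`, `γ`: from `ε²/4 ≤ Γ` follows `ε ≤ 1 + ε²/4 ≤ 2 + 2Γ`.
  obtain ⟨Ca, hCa, hA⟩ := ha.exists_abs_jetOf_le (2 + 2 * Γ) Γ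
  obtain ⟨Cb, hCb, hB⟩ := hb.exists_abs_jetOf_le (2 + 2 * Γ) Γ
  obtain ⟨Cϕ, hCϕ, hP⟩ := hϕ.gevrey.2 _ (isCompact_Icc (a := (-1 : ℝ)) (b := 1))
  set B : ℝ := 2 * (Cb + (1 + 2 * Γ * Ca) * Ca * 2 ^ σ) with hBdef
  have hB₀ : 0 < B := by positivity
  -- Chosen so that `M₁/ε` dominates both `Cϕ/ε`, from the dilated test function, and `2B`, for
  -- every admissible `ε`.
  set M₁ : ℝ := Cϕ + 2 * B * (2 + 2 * Γ) with hM₁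
  have hM₁₀ : 0 < M₁ := by positivity
  set E : ℝ := Real.exp (2 * Γ * Ca) with hE
  have hE₁ : 1 ≤ E := Real.one_le_exp (by positivity)
  -- The first summand pays for one factor `C/ε`, the second for the remaining powers.
  set C : ℝ := c * E * Cϕ + 4 * M₁ * (1 + 2 * Γ) with hC
  have hC₀ : 0 < C := by positivity
  refine ⟨C, hC₀, ?_⟩
  intro N hN m hm hsol f hf hs ε γ hε hεγ hγΓ k
  have hf₀ := eq_zero_of_le_sq hf hs
  have hγ : 0 ≤ γ := le_trans (by positivity) hεγ
  have hεL : ε ≤ 2 + 2 * Γ := by nlinarith [sq_nonneg (ε - 2)]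
  have sϕ := hϕ.gevrey.1
  obtain ⟨hint, hmom⟩ := integrable_and_moment_mean_eq sϕ.continuous hϕ.even hf hf₀
    hm.continuous hε hγ k
  refine ⟨hint, ?_⟩
  have hdom := hN ε γ hε hεγ hγΓ _ (continuous_weightedRadon hf hf₀ hm.continuous)
  have hpow₀ : powWeight 0 m = m := by
    funext x ξ η
    simp [powWeight]
  have cR := continuous_weightedRadon hf hf₀ hm.continuous
  have hrect := (le_max_left _ _).trans hdom
  have hline := (le_max_right _ _).trans hdom
  -- `N` need not be a norm; its nonnegativity on the data comes from domination.
  have hN₀ : 0 ≤ N ε γ (weightedRadon m f) := by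
    have : 0 ≤ c * N ε γ (weightedRadon m f) :=
      le_trans (by unfold rectNorm; positivity) hrect
    exact nonneg_of_mul_nonneg_right this hc
  have hdil : ∀ p, ∀ ξ ∈ Icc (-ε) ε,
      |iteratedDeriv p (dilate ϕ ε) ξ| ≤ Cϕ / ε * ((M₁ / ε) ^ p * (p ! : ℝ) ^ σ) := by
    intro p ξ hξ
    have hξ' : ε⁻¹ * ξ ∈ Icc (-1 : ℝ) 1 := by
      rw [mem_Icc, ← abs_le, abs_mul, abs_of_pos (inv_pos.2 hε), inv_mul_le_iff₀ hε, mul_one]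
      exact abs_le.2 hξ
    have hCM : Cϕ ≤ M₁ := by
      have : 0 ≤ 2 * B * (2 + 2 * Γ) := by positivity
      linarith
    rw [iteratedDeriv_dilate sϕ, abs_mul, abs_mul, abs_of_pos (inv_pos.2 hε),
      abs_of_pos (pow_pos (inv_pos.2 hε) p)]
    calc ε⁻¹ * (ε⁻¹ ^ p * |iteratedDeriv p ϕ (ε⁻¹ * ξ)|)
        ≤ ε⁻¹ * (ε⁻¹ ^ p * (Cϕ ^ (p + 1) * (p ! : ℝ) ^ σ)) := by
          gcongr
          exact hP p _ hξ'
      _ = Cϕ / ε * ((Cϕ / ε) ^ p * (p ! : ℝ) ^ σ) := by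
          rw [div_pow, inv_pow, pow_succ]
          field_simp
      _ ≤ Cϕ / ε * ((M₁ / ε) ^ p * (p ! : ℝ) ^ σ) := by gcongr
  rw [hmom]
  cases k with
  | zero =>
    -- The zeroth moment already pairs `ϕ_ε` with the data on `η = γ`, so no transport is needed.
    have h₁ := norm_integral_le_mul_lineNorm (γ := γ) cR hε.le
      (Y := dilate ϕ ε) (D := Cϕ / ε) (fun ξ hξ => by simpa using hdil 0 ξ hξ)
    rw [hpow₀]
    refine h₁.trans ?_
    have hle : Cϕ * c ≤ C := by
      have h₂ : Cϕ * c * 1 ≤ Cϕ * c * E := by gcongr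
      have h₃ : 0 ≤ 4 * M₁ * (1 + 2 * Γ) := by positivity
      linarith
    calc Cϕ / ε * lineNorm ε γ (weightedRadon m f)
        ≤ Cϕ / ε * (c * N ε γ (weightedRadon m f)) := by gcongr
      _ = Cϕ * c / ε * N ε γ (weightedRadon m f) := by ring
      _ ≤ C / ε * N ε γ (weightedRadon m f) := by gcongr
      _ = _ := by simp
  | succ k =>
    set w : ℕ → ℝ → ℝ → ℝ := jetOf fun ξ _ => dilate ϕ ε ξ with hw
    have jw : IsJet w := isJet_jetOf (by
      have e : (fun p : ℝ × ℝ => dilate ϕ ε p.1) = fun p => ε⁻¹ * ϕ (p.1 / ε) := rfl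
      rw [e]
      fun_prop)
    have w₀ : ∀ ξ η, w 0 ξ η = dilate ϕ ε ξ := fun ξ η => jetOf_zero _ ξ η
    have hend : ∀ p η, ∀ ξ, |ξ| = ε → w p ξ η = 0 := by
      intro p η ξ hξ
      have : iteratedDeriv p ϕ (ε⁻¹ * ξ) = 0 :=
        iteratedDeriv_eq_zero_of_tsupport sϕ hϕ.support_subset p (by
          rw [abs_mul, abs_of_pos (inv_pos.2 hε), hξ, inv_mul_cancel₀ hε.ne'])
      change iteratedDeriv p (dilate ϕ ε) ξ = 0
      rw [iteratedDeriv_dilate sϕ, this]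
      simp
    have key := integral_jetOp_iter_eq ha.1 hb.1 hf hf₀ hm hsol hε.le hεγ jw
      (fun ξ η => by rw [w₀, w₀]) (fun p η => hend p η _ (by rw [abs_neg, abs_of_pos hε]))
      (fun p η => hend p η _ (abs_of_pos hε)) k 0
    simp only [w₀, zero_add, hpow₀] at key
    rw [← norm_neg, ← key]
    have hBM : 2 * B ≤ M₁ / ε := by
      rw [le_div_iff₀ hε]
      have : 2 * B * ε ≤ 2 * B * (2 + 2 * Γ) := by gcongr
      linarith
    have hbound : ∀ ξ ∈ Icc (-ε) ε, ∀ η ∈ Icc (-γ) γ,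
        |Real.exp (jetInt γ (jetOf a) 0 ξ η)
            * jetOp (jetConn a b γ) (jetIter γ (jetConn a b γ) w k) 0 ξ η|
          ≤ E * (Cϕ / ε) * (4 * M₁ * (1 + 2 * Γ) / ε) ^ (k + 1)
            * ((k + 1)! : ℝ) ^ (σ - 1) := by
      intro ξ hξ η hη
      have hξ' : ξ ∈ Icc (-(2 + 2 * Γ)) (2 + 2 * Γ) :=
        ⟨by linarith [hξ.1], by linarith [hξ.2]⟩
      have sub : Icc (-γ) γ ⊆ Icc (-Γ) Γ := Icc_subset_Icc (by linarith) hγΓ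
      exact abs_exp_mul_jetOp_le hσ.le hB₀.le hBM (by positivity) rfl hγΓ hCa.le
        (isJet_jetConn ha.1 hb.1 γ) jw
        (fun η hη => by simpa using hA 0 ξ hξ' η (sub hη))
        (fun i η hη => abs_jetConn_le hσ.le hCa hCb hγ hγΓ
          (fun i η hη => hA i ξ hξ' η (sub hη)) (fun i η hη => hB i ξ hξ' η (sub hη)) i hη)
        (fun p η _ => hdil p ξ hξ) hη k
    refine (norm_integral_le_mul_rectNorm cR hε.le hγ hbound).trans ?_
    have hle₁ : c * E * Cϕ ≤ C := by
      have : 0 ≤ 4 * M₁ * (1 + 2 * Γ) := by positivity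
      linarith
    have hle₂ : 4 * M₁ * (1 + 2 * Γ) ≤ C := by
      have : 0 ≤ c * E * Cϕ := by positivity
      linarith
    calc E * (Cϕ / ε) * (4 * M₁ * (1 + 2 * Γ) / ε) ^ (k + 1) * ((k + 1)! : ℝ) ^ (σ - 1)
          * rectNorm ε γ (weightedRadon m f)
        ≤ E * (Cϕ / ε) * (4 * M₁ * (1 + 2 * Γ) / ε) ^ (k + 1) * ((k + 1)! : ℝ) ^ (σ - 1)
          * (c * N ε γ (weightedRadon m f)) := by gcongr
      _ = (c * E * Cϕ / ε) * (4 * M₁ * (1 + 2 * Γ) / ε) ^ (k + 1) * ((k + 1)! : ℝ) ^ (σ - 1)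
          * N ε γ (weightedRadon m f) := by ring
      _ ≤ (C / ε) * (C / ε) ^ (k + 1) * ((k + 1)! : ℝ) ^ (σ - 1)
          * N ε γ (weightedRadon m f) := by gcongr
      _ = _ := by ring
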